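/- **Setting.** Let $n\ge 2$, $\mathfrak g=\mathfrak{sl}(n,\mathbb C)$, let $\mathbf i=(i_1,\dots,i_N)$ be a reduced expression of the longest element $w_0\in S_n$, and let $\theta=\omega_1+\omega_{n-1}$ be the highest root. For a dominant integral weight $\lambda$ let $\mathcal B(\lambda)$ be the crystal of the irreducible representation of highest weight $\lambda$, with highest weight element $b_\lambda$. A vector $x\in\mathbb Z_{\ge 0}^N$ is an *adapted string* for $\lambda$ if $f_{i_1}^{x_1}\cdots f_{i_N}^{x_N}b_\lambda\ne 0$ and $e_{i_k}\bigl(f_{i_{k+1}}^{x_{k+1}}\cdots f_{i_N}^{x_N}b_\lambda\bigr)=0$ for all $k$; then $x$ is the vector of *string coordinates* of $f_{i_1}^{x_1}\cdots f_{i_N}^{x_N}b_\lambda\in\mathcal B(\lambda)$. The string cone $\mathcal S_{\mathbf i}\subset\mathbb R^N$ is the real cone generated by the adapted strings for all dominant $\lambda$. The string polytope of $\lambda$ is the set of $x\in\mathcal S_{\mathbf i}$ with $x_r\le\langle\lambda-\sum_{r<j\le N}x_j\alpha_{i_j},\alpha_{i_r}^\vee\rangle$ for $1\le r\le N$. Its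 set of lattice points is $\mathcal B_{\mathbf i}(\lambda)$, with weight function $\operatorname{wt}(x)=\lambda-\sum_k x_k\alpha_{i_k}$. For $1\le k\le n-1$ put $$z_k=f_kf_{k+1}\cdots f_{n-1}\,f_{k-1}f_{k-2}\cdots f_1\,b_\theta\in\mathcal B(\theta).$$ The wiring diagram of $\mathbf i$ has wires $\ell_1,\dots,\ell_n$, labelled at the left from bottom to top; its $p$-th crossing, from left to right, is between the wires at levels $i_p$ and $i_p+1$. **Lemma.** Every $z_k$ is a (nonzero) element of $\mathcal B(\theta)$ with a unique vector of string coordinates, also denoted $z_k$, and: (i) The set of elements of weight zero of $\mathcal B_{\mathbf i}(\theta)$ is $\{z_1,\dots,z_{n-1}\}$. (ii) For each $1\le k\le n-1$, the string coordinates of $z_k$ form a $0/1$ vector. The ones are at the positions found by the greedy search for the word $u=(k,k+1,\dots,n-1,k-1,k-2,\dots,1)$ as a subword of $\mathbf i$ up to commutation: read $\mathbf i$ from left to right; whenever the current letter $a$ occurs in the remaining word $u$ and can be moved to its front by commutations (every letter $b$ before it satisfies $|a-b|\ge 2$), take this position and delete $a$ from $u$; otherwise skip the position. The word $u$ is exhausted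 at the end of $\mathbf i$. (iii) For $i<j$ the wires $\ell_i$ and $\ell_j$ cross exactly once. Write $x_{(i,j)}$ for the coordinate of $x$ at this crossing. Then $(z_1)_{(i,j)}=1$ if $i=1$ and $0$ otherwise, and $(z_{n-1})_{(i,j)}=1$ if $j=n$ and $0$ otherwise. -/

import Mathlib

/-!
Type `A_r`, that is `𝔤 = 𝔰𝔩_n` with `n = r + 1`.  Indices are shifted by one: `a : Fin r` stands
for the node `a + 1 ∈ {1, …, n - 1}` of the Dynkin diagram, and `x : Fin (r + 1)` for the letter
(or the wire, or the level) `x + 1 ∈ {1, …, n}`.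
-/

namespace StringCrystal

/-! ### The crystals `B(λ)` inside tensor powers of the standard crystal -/

/-- The word `[x₁, …, x_l]` is the element `x₁ ⊗ ⋯ ⊗ x_l` of the `l`-th tensor power of the
crystal `1 → 2 → ⋯ → n` of the standard representation of `𝔰𝔩_n`. -/
abbrev Word (r : ℕ) := List (Fin (r + 1))

/-- `φ_a` on the standard crystal. -/
def letterPhi {r : ℕ} (a : Fin r) (x : Fin (r + 1)) : ℕ := if x = a.castSucc then 1 else 0

/-- `ε_a` on the standard crystal. -/
def letterEps {r : ℕ} (a : Fin r) (x : Fin (r + 1)) : ℕ := if x = a.succ then 1 else 0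

/-- `f_a` on the standard crystal; `none` is the `0` of crystal theory. -/
def letterF {r : ℕ} (a : Fin r) (x : Fin (r + 1)) : Option (Fin (r + 1)) :=
  if x = a.castSucc then some a.succ else none

/-- `e_a` on the standard crystal. -/
def letterE {r : ℕ} (a : Fin r) (x : Fin (r + 1)) : Option (Fin (r + 1)) :=
  if x = a.succ then some a.castSucc else none

/-- `φ_a(x ⊗ y) = max (φ_a x) (φ_a y + ⟨wt x, α_a^∨⟩) = φ_a x + max 0 (φ_a y - ε_a x)`
(the subtraction of natural numbers is truncated at `0`). -/
def phi {r : ℕ} (a : Fin r) : Word r → ℕ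
  | [] => 0
  | x :: w => letterPhi a x + (phi a w - letterEps a x)

/-- The tensor product rule
`f_a(x ⊗ y) = f_a x ⊗ y` if `φ_a y ≤ ε_a x`, and `x ⊗ f_a y` otherwise. -/
def f {r : ℕ} (a : Fin r) : Word r → Option (Word r)
  | [] => none
  | x :: w =>
    if phi a w ≤ letterEps a x then (letterF a x).map (fun y => y :: w)
    else (f a w).map (fun v => x :: v)

/-- The tensor product rule
`e_a(x ⊗ y) = e_a x ⊗ y` if `φ_a y < ε_a x`, and `x ⊗ e_a y` otherwise. -/
def e {r : ℕ} (a : Fin r) : Word r → Option (Word r)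
  | [] => none
  | x :: w =>
    if phi a w < letterEps a x then (letterE a x).map (fun y => y :: w)
    else (e a w).map (fun v => x :: v)

/-- The highest weight element `a ⊗ ⋯ ⊗ 2 ⊗ 1` of the crystal of the fundamental weight `ω_a`. -/
def column {r : ℕ} (a : Fin r) : Word r :=
  ((List.finRange (r + 1)).filter (fun x => x ≤ a.castSucc)).reverse

/-- The highest weight element `b_λ` for `λ = ∑ a, lam a • ω_a`: the tensor product of `lam a`
copies of `b_{ω_a}` for all `a`.  The crystal `B(λ)` is the connected component of `b_λ`. -/
def highest {r : ℕ} (lam : Fin r → ℕ) : Word r :=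
  (List.finRange r).flatMap (fun a => (List.replicate (lam a) (column a)).flatten)

/-- `f_a^m`. -/
def fPow {r : ℕ} (a : Fin r) : ℕ → Word r → Option (Word r)
  | 0, b => some b
  | m + 1, b => (fPow a m b).bind (f a)

/-- `lower [(a₁, m₁), …, (a_l, m_l)] b = f_{a₁}^{m₁} ⋯ f_{a_l}^{m_l} b`. -/
def lower {r : ℕ} : List (Fin r × ℕ) → Word r → Option (Word r)
  | [], b => some b
  | (a, m) :: l, b => (lower l b).bind (fPow a m)

/-! ### Reduced expressions, strings and string polytopes -/

/-- The product of the simple transpositions `s_{i₁} ⋯ s_{i_N}` in the symmetric group `S_n`. -/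
def permOf {r : ℕ} (i : List (Fin r)) : Equiv.Perm (Fin (r + 1)) :=
  (i.map (fun a => Equiv.swap a.castSucc a.succ)).prod

/-- `i` is a reduced expression of the longest element `w₀ : x ↦ n + 1 - x` of `S_n`. -/
def IsReducedLongest {r : ℕ} (i : List (Fin r)) : Prop :=
  permOf i = Fin.revPerm ∧ ∀ i' : List (Fin r), permOf i' = Fin.revPerm → i.length ≤ i'.length

/-- The pairs `(i_1, x_1), …, (i_N, x_N)`. -/
def pairs {r : ℕ} (i : List (Fin r)) (x : Fin i.length → ℕ) : List (Fin r × ℕ) :=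
  List.ofFn (fun p => (i.get p, x p))

/-- `x` is an adapted string for `λ` and `i`: `f_{i_1}^{x_1} ⋯ f_{i_N}^{x_N} b_λ ≠ 0` and
`e_{i_p} (f_{i_{p+1}}^{x_{p+1}} ⋯ f_{i_N}^{x_N} b_λ) = 0` for all `p`. -/
def IsAdapted {r : ℕ} (i : List (Fin r)) (lam : Fin r → ℕ) (x : Fin i.length → ℕ) : Prop :=
  lower (pairs i x) (highest lam) ≠ none ∧
    ∀ p : Fin i.length,
      (lower ((pairs i x).drop (p + 1)) (highest lam)).bind (e (i.get p)) = none

/-- `x` is the vector of string coordinates of the element `b` of `B(λ)`. -/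
def IsStringOf {r : ℕ} (i : List (Fin r)) (lam : Fin r → ℕ) (b : Option (Word r))
    (x : Fin i.length → ℕ) : Prop :=
  IsAdapted i lam x ∧ lower (pairs i x) (highest lam) = b

/-- The string cone: the real cone generated by all adapted strings, for all dominant `λ`. -/
noncomputable def stringCone {r : ℕ} (i : List (Fin r)) : PointedCone ℝ (Fin i.length → ℝ) :=
  PointedCone.hull ℝ {y | ∃ (lam : Fin r → ℕ) (x : Fin i.length → ℕ),
    IsAdapted i lam x ∧ y = fun p => (x p : ℝ)}

/-- The string polytope: the points of the string cone with
`y_p ≤ ⟨λ - ∑_{q > p} y_q α_{i_q}, α_{i_p}^∨⟩` for all `p`. -/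
def stringPolytope {r : ℕ} (i : List (Fin r)) (lam : Fin r → ℕ) : Set (Fin i.length → ℝ) :=
  {y | y ∈ stringCone i ∧ ∀ p, y p ≤
    (lam (i.get p) : ℝ) - ∑ q ∈ Finset.Ioi p, y q * (CartanMatrix.A r (i.get p) (i.get q) : ℝ)}

/-- The underlying set of `B_i(λ)`: the lattice points of the string polytope. -/
def latticePoints {r : ℕ} (i : List (Fin r)) (lam : Fin r → ℕ) : Set (Fin i.length → ℤ) :=
  {x | (fun p => (x p : ℝ)) ∈ stringPolytope i lam}

/-- `wt x = λ - ∑ p, x_p α_{i_p}`, written in the basis of fundamental weights. -/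
def weight {r : ℕ} (i : List (Fin r)) (lam : Fin r → ℕ) (x : Fin i.length → ℤ) : Fin r → ℤ :=
  fun a => (lam a : ℤ) - ∑ p, x p * CartanMatrix.A r a (i.get p)

/-- The highest root `θ = ω_1 + ω_{n-1}` (which is `2 ω_1` for `n = 2`). -/
def theta (r : ℕ) : Fin r → ℕ :=
  fun a => (if (a : ℕ) = 0 then 1 else 0) + (if (a : ℕ) + 1 = r then 1 else 0)

/-! ### The elements `z_k` and the greedy subword -/

/-- The word `k, k + 1, …, n - 1, k - 1, k - 2, …, 1`. -/
def zWord {r : ℕ} (k : Fin r) : List (Fin r) :=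
  (List.finRange r).filter (fun a => k ≤ a) ++ ((List.finRange r).filter (fun a => a < k)).reverse

/-- `z_k = f_k f_{k+1} ⋯ f_{n-1} f_{k-1} f_{k-2} ⋯ f_1 b_θ` in `B(θ)`. -/
def zElt {r : ℕ} (k : Fin r) : Option (Word r) :=
  lower ((zWord k).map (fun a => (a, 1))) (highest (theta r))

/-- The letter `a` occurs in `u`, and its first occurrence can be moved to the front of `u` by
commutations: all letters `b` in front of it satisfy `|a - b| ≥ 2`. -/
def CanLead {r : ℕ} (a : Fin r) (u : List (Fin r)) : Prop :=
  a ∈ u ∧ ∀ b ∈ u.takeWhile (fun b => b ≠ a), (a : ℕ) + 2 ≤ b ∨ (b : ℕ) + 2 ≤ a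

instance {r : ℕ} (a : Fin r) (u : List (Fin r)) : Decidable (CanLead a u) := by
  unfold CanLead; infer_instance

/-- Greedy search for `u`, up to commutation, as a subword of `i`.  The word `i` is read from left
to right.  A letter of `i` is taken, and deleted from what remains of `u`, as soon as it can lead a
word in the commutation class of that remainder.  The result is the `0/1` indicator of the
positions taken, or `none` if `u` is not exhausted at the end of `i`. -/
def greedy {r : ℕ} : List (Fin r) → List (Fin r) → Option (List ℕ)
  | [], u => if u = [] then some [] else none
  | a :: i, u =>
    if CanLead a u then (greedy i (u.erase a)).map (fun l => 1 :: l)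
    else (greedy i u).map (fun l => 0 :: l)

/-! ### The wiring diagram -/

/-- The wire that is at level `l` after the first `m` crossings of the wiring diagram of `i`. Wires
are labelled at the left from bottom to top, and a letter `a` of `i` crosses levels `a`, `a + 1`. -/
def wireAt {r : ℕ} (i : List (Fin r)) : ℕ → Fin (r + 1) → Fin (r + 1)
  | 0, l => l
  | m + 1, l =>
    match i[m]? with
    | some a => wireAt i m (Equiv.swap a.castSucc a.succ l)
    | none => wireAt i m l

/-- The `p`-th crossing of the wiring diagram of `i` is a crossing of the wires `u` and `v`. -/
def IsCrossing {r : ℕ} (i : List (Fin r)) (p : Fin i.length) (u v : Fin (r + 1)) : Prop :=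
  (wireAt i p (i.get p).castSucc = u ∧ wireAt i p (i.get p).succ = v) ∨
    (wireAt i p (i.get p).castSucc = v ∧ wireAt i p (i.get p).succ = u)

end StringCrystal

/-! The crystal `B(θ)` is realised by words `x ⊗ (column omitting y)` of weight `e_x - e_y`, so an
element is a pair of levels `(x, y)`. On the pairs that matter, `e_c` moves `y` from `c` up to `c +
1` or `x` from `c + 1` down to `c`. The element `z_k` is the diagonal pair `(k, k)` and `b_θ` is the
pair (lowest, highest). String coordinates are read off by applying `e_{i_1}, e_{i_2}, …` as often
as possible. Along this path one application always exhausts `e_c` (`eps_adjointWord_step`), so the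
coordinates are 0/1. The path ends at `b_θ` because the invariant `LevelInvariant`, which compares
`(x, y)` with the levels of the wires up to `k` and above `k`, leaves no other pair once the wires
are reversed (`finalState_eq`).

For (ii), the word left over in state `(x, y)` is `y, y + 1, …` followed by `x - 1, x - 2, …`; a
letter can lead it exactly when the state moves (`greedy_remaining`). For (iii), the moving
component of the state follows the bottom wire for `z_1` and the top wire for `z_{n-1}`; since two
wires cross once, these wires move monotonically and every crossing on them is a move.

For (i), invertibility of the Cartan matrix shows that a lattice point of weight zero takes each
letter at exactly one position. The polytope inequalities make these positions increase in both
directions away from some letter `k` (`positions_unimodal`). The cone inequality for consecutive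
occurrences of a letter (`IsPath.le_sum`) then forces each position to be the earliest possible one,
which is the raising path of `z_k` (`eq_digitFun`). Conversely, adapted strings lie in the polytope
because `φ` measures how often `f` applies. -/

namespace StringCrystal

/-! ### Crystal axioms for words -/

/-- `ε_a` on words. -/
def eps {r : ℕ} (a : Fin r) : Word r → ℕ
  | [] => 0
  | x :: w => eps a w + (letterEps a x - phi a w)

theorem letterPhi_castSucc {r : ℕ} (a : Fin r) (c : Fin r) :
    letterPhi a c.castSucc = if (c : ℕ) = a then 1 else 0 := by
  simp [letterPhi, Fin.ext_iff]

theorem letterPhi_succ {r : ℕ} (a : Fin r) (c : Fin r) :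
    letterPhi a c.succ = if (c : ℕ) + 1 = a then 1 else 0 := by
  simp [letterPhi, Fin.ext_iff]

theorem letterEps_castSucc {r : ℕ} (a : Fin r) (c : Fin r) :
    letterEps a c.castSucc = if (c : ℕ) = a + 1 then 1 else 0 := by
  simp [letterEps, Fin.ext_iff]

theorem letterEps_succ {r : ℕ} (a : Fin r) (c : Fin r) :
    letterEps a c.succ = if (c : ℕ) = a then 1 else 0 := by
  simp [letterEps, Fin.ext_iff]

theorem f_cons_eq_some {r : ℕ} {c : Fin r} {x : Fin (r + 1)} {w w' : Word r}
    (h : f c (x :: w) = some w') :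
    (phi c w ≤ letterEps c x ∧ x = c.castSucc ∧ w' = c.succ :: w) ∨
      (letterEps c x < phi c w ∧ ∃ v, f c w = some v ∧ w' = x :: v) := by
  rw [f] at h
  split_ifs at h with h1
  · left
    unfold letterF at h
    split_ifs at h with h2
    · simp only [Option.map_some, Option.some.injEq] at h
      exact ⟨h1, h2, h.symm⟩
    · simp at h
  · right
    rw [Option.map_eq_some_iff] at h
    obtain ⟨v, hv, rfl⟩ := h
    exact ⟨not_le.1 h1, v, hv, rfl⟩

/-- The comparison of `φ` and `ε` in the tensor product rule selects the same factor for `e` after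
`f` has acted. If `f` acts on the first letter, that letter has `ε = 0`, so the tail has `φ = 0` and
the new letter has `ε = 1`. -/
theorem e_phi_eps_of_f {r : ℕ} {a : Fin r} : ∀ {w w' : Word r}, f a w = some w' →
    e a w' = some w ∧ phi a w = phi a w' + 1 ∧ eps a w' = eps a w + 1
  | [], w', h => by simp [f] at h
  | x :: w, w', h => by
    rcases f_cons_eq_some h with ⟨h1, rfl, rfl⟩ | ⟨h1, v, hv, rfl⟩
    · simp only [letterEps_castSucc] at h1
      have h0 : phi a w = 0 := by simpa using h1
      simp [e, phi, eps, h0, letterEps_succ, letterPhi_succ, letterEps_castSucc,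
        letterPhi_castSucc, letterE]
    · obtain ⟨he, hp, hq⟩ := e_phi_eps_of_f hv
      refine ⟨?_, ?_, ?_⟩
      · rw [e, if_neg (by omega), he]; rfl
      · simp only [phi]; omega
      · simp only [eps]; omega

theorem e_eq_none_iff {r : ℕ} {a : Fin r} : ∀ {w : Word r}, e a w = none ↔ eps a w = 0
  | [] => by simp [e, eps]
  | x :: w => by
    have ih := e_eq_none_iff (a := a) (w := w)
    rw [e, eps]
    split_ifs with h
    · have hx : x = a.succ := by
        by_contra hx
        simp [letterEps, hx] at h
      have : letterE a x ≠ none := by simp [letterE, hx]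
      simp only [Option.map_eq_none_iff, this, false_iff]
      omega
    · rw [Option.map_eq_none_iff, ih]
      omega

/-- `a` and `c` are neighbours in the Dynkin diagram. -/
def Neighbor {r : ℕ} (a c : Fin r) : Prop := (a : ℕ) + 1 = c ∨ (c : ℕ) + 1 = a

instance {r : ℕ} (a c : Fin r) : Decidable (Neighbor a c) := by
  unfold Neighbor; infer_instance

/-- Sharper than the change of weight, which only fixes `φ - ε`. The bound it gives on the drop of
`ε_a` is the source of the string cone inequalities. -/
theorem phi_eps_of_f_neighbor {r : ℕ} {a c : Fin r} (hac : Neighbor a c) :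
    ∀ {w w' : Word r}, f c w = some w' →
      (phi a w' = phi a w + 1 ∧ eps a w' = eps a w) ∨
        (phi a w' = phi a w ∧ eps a w = eps a w' + 1)
  | [], w', h => by simp [f] at h
  | x :: w, w', h => by
    rcases f_cons_eq_some h with ⟨h1, rfl, rfl⟩ | ⟨h1, v, hv, rfl⟩
    · simp only [phi, eps, letterEps_castSucc, letterPhi_castSucc, letterEps_succ, letterPhi_succ]
      unfold Neighbor at hac
      split_ifs <;> omega
    · have := phi_eps_of_f_neighbor hac hv
      simp only [phi, eps]
      omega

theorem phi_eps_of_f_far {r : ℕ} {a c : Fin r} (hac : ¬ Neighbor a c) (hne : c ≠ a) :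
    ∀ {w w' : Word r}, f c w = some w' → phi a w' = phi a w ∧ eps a w' = eps a w
  | [], w', h => by simp [f] at h
  | x :: w, w', h => by
    have hne' : (c : ℕ) ≠ a := fun h => hne (Fin.ext h)
    rcases f_cons_eq_some h with ⟨h1, rfl, rfl⟩ | ⟨h1, v, hv, rfl⟩
    · simp only [phi, eps, letterEps_castSucc, letterPhi_castSucc, letterEps_succ, letterPhi_succ]
      unfold Neighbor at hac
      split_ifs <;> omega
    · have := phi_eps_of_f_far hac hne hv
      simp only [phi, eps]
      omega

/-- The pairing of the weight of a word with `α_a^∨`. -/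
def wordWeight {r : ℕ} (a : Fin r) (w : Word r) : ℤ := (phi a w : ℤ) - eps a w

theorem cartan_apply {r : ℕ} (a c : Fin r) :
    CartanMatrix.A r a c = if a = c then 2 else if Neighbor a c then -1 else 0 := by
  simp [CartanMatrix.A, Neighbor]

theorem wordWeight_of_f {r : ℕ} {a c : Fin r} {w w' : Word r} (h : f c w = some w') :
    wordWeight a w' = wordWeight a w - CartanMatrix.A r a c := by
  rw [cartan_apply]
  unfold wordWeight
  split_ifs with h1 h2
  · subst h1
    have := e_phi_eps_of_f h
    omega
  · have := phi_eps_of_f_neighbor h2 h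
    omega
  · have := phi_eps_of_f_far h2 (Ne.symm h1) h
    omega

/-! ### Powers of the lowering operators -/

theorem fPow_succ_eq_some {r : ℕ} {a : Fin r} {m : ℕ} {v w : Word r}
    (h : fPow a (m + 1) v = some w) : ∃ u, fPow a m v = some u ∧ f a u = some w := by
  rwa [fPow, Option.bind_eq_some_iff] at h

theorem phi_eps_of_fPow {r : ℕ} {a : Fin r} {m : ℕ} {v w : Word r} (h : fPow a m v = some w) :
    phi a v = phi a w + m ∧ eps a w = eps a v + m := by
  induction m generalizing w with
  | zero => simp only [fPow, Option.some.injEq] at h; simp [h]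
  | succ m ih =>
    obtain ⟨u, hu, hw⟩ := fPow_succ_eq_some h
    have := ih hu
    have := e_phi_eps_of_f hw
    omega

theorem eps_le_of_fPow {r : ℕ} {a c : Fin r} (hne : c ≠ a) {m : ℕ} {v w : Word r}
    (h : fPow c m v = some w) : eps a v ≤ eps a w + if Neighbor a c then m else 0 := by
  induction m generalizing w with
  | zero => simp only [fPow, Option.some.injEq] at h; simp [h]
  | succ m ih =>
    obtain ⟨u, hu, hw⟩ := fPow_succ_eq_some h
    have h1 := ih hu
    split_ifs at h1 ⊢ with h2
    · have := phi_eps_of_f_neighbor h2 hw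
      omega
    · have := phi_eps_of_f_far h2 hne hw
      omega

theorem wordWeight_of_fPow {r : ℕ} {a c : Fin r} {m : ℕ} {v w : Word r}
    (h : fPow c m v = some w) :
    wordWeight a w = wordWeight a v - m * CartanMatrix.A r a c := by
  induction m generalizing w with
  | zero => simp only [fPow, Option.some.injEq] at h; simp [h]
  | succ m ih =>
    obtain ⟨u, hu, hw⟩ := fPow_succ_eq_some h
    rw [wordWeight_of_f hw, ih hu]
    push_cast
    ring

theorem fPow_injective {r : ℕ} {a : Fin r} {m : ℕ} {v v' w : Word r}
    (h : fPow a m v = some w) (h' : fPow a m v' = some w) : v = v' := by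
  induction m generalizing w with
  | zero => simp only [fPow, Option.some.injEq] at h h'; rw [h, h']
  | succ m ih =>
    obtain ⟨u, hu, hw⟩ := fPow_succ_eq_some h
    obtain ⟨u', hu', hw'⟩ := fPow_succ_eq_some h'
    have h1 := (e_phi_eps_of_f hw).1
    rw [(e_phi_eps_of_f hw').1, Option.some.injEq] at h1
    exact ih hu (h1 ▸ hu')

theorem lower_cons_eq_some {r : ℕ} {a : Fin r} {m : ℕ} {l : List (Fin r × ℕ)} {b w : Word r}
    (h : lower ((a, m) :: l) b = some w) : ∃ v, lower l b = some v ∧ fPow a m v = some w := by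
  rwa [lower, Option.bind_eq_some_iff] at h

section

/-! ### Adapted strings -/

theorem drop_pairs {r : ℕ} (i : List (Fin r)) (x : Fin i.length → ℕ) (s : Fin i.length) :
    (pairs i x).drop s = (i.get s, x s) :: (pairs i x).drop (s + 1) := by
  rw [List.drop_eq_getElem_cons (by simp [pairs])]
  simp [pairs]

/-- `B s = f_{i_{s+1}}^{x_{s+1}} ⋯ f_{i_N}^{x_N} b_λ` for all `s`, where `x` is adapted. -/
structure IsPath {r : ℕ} (i : List (Fin r)) (lam : Fin r → ℕ) (x : Fin i.length → ℕ)
    (B : ℕ → Word r) : Prop where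
  fPow_eq : ∀ s : Fin i.length, fPow (i.get s) (x s) (B (s + 1)) = some (B s)
  eps_eq_zero : ∀ s : Fin i.length, eps (i.get s) (B (s + 1)) = 0
  last : B i.length = highest lam
  zero : lower (pairs i x) (highest lam) = some (B 0)

theorem IsAdapted.exists_isPath {r : ℕ} {i : List (Fin r)} {lam : Fin r → ℕ}
    {x : Fin i.length → ℕ} (h : IsAdapted i lam x) : ∃ B, IsPath i lam x B := by
  have key : ∀ m, ∃ w, lower ((pairs i x).drop m) (highest lam) = some w := by
    intro m
    induction m with
    | zero => exact Option.ne_none_iff_exists'.1 h.1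
    | succ m ih =>
      obtain ⟨w, hw⟩ := ih
      by_cases hm : m < i.length
      · have hd := drop_pairs i x ⟨m, hm⟩
        simp only at hd
        rw [hd] at hw
        obtain ⟨v, hv, -⟩ := lower_cons_eq_some hw
        exact ⟨v, hv⟩
      · rw [List.drop_eq_nil_of_le (by simp [pairs]; omega)]
        exact ⟨_, rfl⟩
  choose B hB using key
  refine ⟨B, fun s => ?_, fun s => ?_, ?_, hB 0⟩
  · have h1 := hB s
    rw [drop_pairs, lower, hB] at h1
    exact h1
  · have h1 := h.2 s
    rw [hB] at h1
    exact e_eq_none_iff.1 h1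
  · have h1 := hB i.length
    rw [List.drop_eq_nil_of_le (by simp [pairs]), lower, Option.some.injEq] at h1
    exact h1.symm

variable {r : ℕ} {i : List (Fin r)} {lam : Fin r → ℕ} {x : Fin i.length → ℕ} {B : ℕ → Word r}

theorem IsPath.eps_eq (h : IsPath i lam x B) (s : Fin i.length) :
    eps (i.get s) (B s) = x s := by
  have h1 := phi_eps_of_fPow (h.fPow_eq s)
  have h2 := h.eps_eq_zero s
  omega

/-- Each exponent is recovered as `ε` of the current element, and powers of `f` are injective where
defined, so the path can be retraced from `B 0`. -/
theorem IsPath.unique {x' : Fin i.length → ℕ} {B' : ℕ → Word r} (h : IsPath i lam x B)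
    (h' : IsPath i lam x' B') (h0 : B 0 = B' 0) : x = x' := by
  have hB : ∀ m, m ≤ i.length → B m = B' m := by
    intro m
    induction m with
    | zero => exact fun _ => h0
    | succ m ih =>
      intro hm
      have h1 := ih (by omega)
      have h2 := h.fPow_eq ⟨m, hm⟩
      have h3 := h'.fPow_eq ⟨m, hm⟩
      rw [← h.eps_eq] at h2
      rw [← h'.eps_eq, ← h1] at h3
      exact fPow_injective h2 h3
  funext s
  rw [← h.eps_eq, ← h'.eps_eq, hB s s.2.le]

/-- Follow `ε` for the common letter from `B (p + 1)`, where it vanishes, to `B q`, where it equals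
`x q`. In between it can grow only at neighbouring letters, at position `s` by at most `x s`. -/
theorem IsPath.le_sum (h : IsPath i lam x B) {p q : Fin i.length} (hpq : p < q)
    (hi : i.get p = i.get q) (hne : ∀ s, p < s → s < q → i.get s ≠ i.get q) :
    x q ≤ ∑ s with p < s ∧ s < q ∧ Neighbor (i.get q) (i.get s), x s := by
  have key : ∀ m : ℕ, p < m → m ≤ q →
      eps (i.get q) (B m) ≤ ∑ s with p < s ∧ (s : ℕ) < m ∧ Neighbor (i.get q) (i.get s), x s := by
    intro m hm
    induction m, hm using Nat.le_induction with
    | base =>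
      intro _
      have h1 := h.eps_eq_zero p
      rw [hi] at h1
      exact h1.le.trans (Nat.zero_le _)
    | succ m hm ih =>
      intro hmq
      have hmN : m < i.length := by omega
      have h1 := ih (by omega)
      have h2 := eps_le_of_fPow (hne ⟨m, hmN⟩ (Fin.lt_def.2 hm) (Fin.lt_def.2 hmq))
        (h.fPow_eq ⟨m, hmN⟩)
      simp only at h2
      split_ifs at h2 with hn
      · have hs : (Finset.univ.filter fun s : Fin i.length =>
            p < s ∧ (s : ℕ) < m + 1 ∧ Neighbor (i.get q) (i.get s)) =
            insert ⟨m, hmN⟩ (Finset.univ.filter fun s : Fin i.length =>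
              p < s ∧ (s : ℕ) < m ∧ Neighbor (i.get q) (i.get s)) := by
          ext s
          simp only [Finset.mem_filter, Finset.mem_univ, true_and, Finset.mem_insert]
          constructor
          · rintro ⟨h3, h4, h5⟩
            by_cases h6 : (s : ℕ) = m
            · exact Or.inl (Fin.ext h6)
            · exact Or.inr ⟨h3, by omega, h5⟩
          · rintro (rfl | ⟨h3, h4, h5⟩)
            · exact ⟨Fin.lt_def.2 hm, by simp, hn⟩
            · exact ⟨h3, by omega, h5⟩
        rw [hs, Finset.sum_insert (by simp)]
        have h3 := h.fPow_eq ⟨m, hmN⟩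
        omega
      · refine (h2.trans h1).trans (Finset.sum_le_sum_of_subset fun s => ?_)
        simp only [Finset.mem_filter, Finset.mem_univ, true_and]
        rintro ⟨h3, h4, h5⟩
        exact ⟨h3, by omega, h5⟩
  rw [← h.eps_eq]
  exact key q hpq le_rfl

theorem IsPath.wordWeight_eq (h : IsPath i lam x B) (a : Fin r) {m : ℕ} (hm : m ≤ i.length) :
    wordWeight a (B m) = wordWeight a (highest lam) -
      ∑ s ∈ Finset.univ.filter (fun s : Fin i.length => m ≤ (s : ℕ)), (x s : ℤ) * CartanMatrix.A r a (i.get s) := by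
  obtain ⟨k, hk⟩ := Nat.exists_eq_add_of_le hm
  induction k generalizing m with
  | zero =>
    have hs : (Finset.univ.filter fun s : Fin i.length => m ≤ (s : ℕ)) = ∅ := by
      ext s
      have := s.2
      simp only [Finset.mem_filter, Finset.mem_univ, true_and, Finset.notMem_empty, iff_false]
      omega
    have hm' : m = i.length := by omega
    rw [hs, Finset.sum_empty, sub_zero, hm', h.last]
  | succ k ih =>
    have hmN : m < i.length := by omega
    have h1 := wordWeight_of_fPow (a := a) (h.fPow_eq ⟨m, hmN⟩)
    simp only at h1
    have hs : (Finset.univ.filter fun s : Fin i.length => m ≤ (s : ℕ)) =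
        insert ⟨m, hmN⟩ (Finset.univ.filter fun s : Fin i.length => m + 1 ≤ (s : ℕ)) := by
      ext s
      simp only [Finset.mem_filter, Finset.mem_univ, true_and, Finset.mem_insert, Fin.ext_iff]
      omega
    rw [h1, ih (m := m + 1) (by omega) (by omega), hs, Finset.sum_insert (by simp)]
    ring

/-! ### Inequalities of the string cone -/

theorem nonneg_of_mem_stringCone {y : Fin i.length → ℝ} (hy : y ∈ stringCone i)
    (p : Fin i.length) : 0 ≤ y p := by
  unfold stringCone at hy
  induction hy using Submodule.span_induction with
  | mem y hy => obtain ⟨_, x, -, rfl⟩ := hy; exact Nat.cast_nonneg _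
  | zero => exact le_rfl
  | add y z _ _ h1 h2 => exact add_nonneg h1 h2
  | smul c y _ h => exact mul_nonneg c.2 h

/-- The inequality is linear and homogeneous, so it passes from adapted strings to the cone they
generate. -/
theorem le_sum_of_mem_stringCone {y : Fin i.length → ℝ} (hy : y ∈ stringCone i)
    {p q : Fin i.length} (hpq : p < q) (hi : i.get p = i.get q)
    (hne : ∀ s, p < s → s < q → i.get s ≠ i.get q) :
    y q ≤ ∑ s with p < s ∧ s < q ∧ Neighbor (i.get q) (i.get s), y s := by
  unfold stringCone at hy
  induction hy using Submodule.span_induction with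
  | mem y hy =>
    obtain ⟨_, x, hx, rfl⟩ := hy
    obtain ⟨B, hB⟩ := hx.exists_isPath
    simp only
    exact_mod_cast hB.le_sum hpq hi hne
  | zero => simp
  | add y z _ _ h1 h2 =>
    simp only [Pi.add_apply, Finset.sum_add_distrib]
    exact add_le_add h1 h2
  | smul c y _ h =>
    have : ∀ s, (c • y) s = (c : ℝ) * y s := fun _ => rfl
    simp only [this, ← Finset.mul_sum]
    exact mul_le_mul_of_nonneg_left h c.2

/-- At each position `ε = 0`, so the pairing of the weight with the coroot is `φ`, and `φ` bounds
the exponent of a power of `f` that does not vanish. -/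
theorem IsAdapted.mem_latticePoints (h : IsAdapted i lam x)
    (hlam : ∀ a, wordWeight a (highest lam) = lam a) :
    (fun p => (x p : ℤ)) ∈ latticePoints i lam := by
  obtain ⟨B, hB⟩ := h.exists_isPath
  refine ⟨?_, fun p => ?_⟩
  · simp only [Int.cast_natCast]
    exact Submodule.subset_span ⟨lam, x, h, rfl⟩
  · have h1 := hB.wordWeight_eq (i.get p) (m := p + 1) p.2
    have h2 := phi_eps_of_fPow (hB.fPow_eq p)
    have h3 := hB.eps_eq_zero p
    have hs : (Finset.univ.filter fun s : Fin i.length => (p : ℕ) + 1 ≤ s) = Finset.Ioi p := by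
      ext s
      simp only [Finset.mem_filter, Finset.mem_univ, true_and, Finset.mem_Ioi, Fin.lt_def,
        Nat.succ_le_iff]
    rw [hlam, hs] at h1
    have h4 : (x p : ℤ) ≤ lam (i.get p) -
        ∑ s ∈ Finset.Ioi p, (x s : ℤ) * CartanMatrix.A r (i.get p) (i.get s) := by
      rw [← h1, wordWeight]
      omega
    beta_reduce
    exact_mod_cast h4

theorem IsPath.weight_eq (h : IsPath i lam x B)
    (hlam : ∀ a, wordWeight a (highest lam) = lam a) :
    weight i lam (fun p => (x p : ℤ)) = fun a => wordWeight a (B 0) := by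
  funext a
  rw [h.wordWeight_eq a (Nat.zero_le _), hlam]
  simp [weight]

end

/-! ### Columns of length `n - 1` and the words of the adjoint crystal -/

/-- When both letters occur, `a.succ` stands before `a.castSucc` and the two cancel. -/
theorem phi_eps_of_decreasing {r : ℕ} (a : Fin r) : ∀ {w : Word r}, w.Pairwise (· > ·) →
    phi a w = (if a.castSucc ∈ w ∧ a.succ ∉ w then 1 else 0) ∧
      eps a w = (if a.succ ∈ w ∧ a.castSucc ∉ w then 1 else 0)
  | [], _ => by simp [phi, eps]
  | x :: w, h => by
    rw [List.pairwise_cons] at h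
    obtain ⟨hp, he⟩ := phi_eps_of_decreasing a h.2
    have hx : x ∉ w := fun hx => lt_irrefl _ (h.1 x hx)
    have hlt := Fin.castSucc_lt_succ (i := a)
    by_cases h1 : x = a.castSucc
    · subst h1
      have h2 : a.succ ∉ w := fun h2 => lt_asymm hlt (h.1 _ h2)
      simp [phi, eps, hp, he, hx, h2, letterPhi_castSucc, letterEps_castSucc, hlt.ne']
    · by_cases h2 : x = a.succ
      · subst h2
        simp only [phi, eps, hp, he, hx, letterPhi_succ, letterEps_succ, List.mem_cons, hlt.ne,
          false_or, true_or, not_true, and_false, false_and, if_false, if_true, not_false_eq_true,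
          and_true, true_and]
        split_ifs <;> simp_all
      · simp [phi, eps, hp, he, letterPhi, letterEps, h1, h2, Ne.symm h1, Ne.symm h2]

theorem f_of_decreasing {r : ℕ} (a : Fin r) : ∀ {w : Word r}, w.Pairwise (· > ·) →
    a.castSucc ∈ w → a.succ ∉ w → ∃ w', f a w = some w' ∧ w'.Pairwise (· > ·) ∧
      ∀ z, z ∈ w' ↔ z = a.succ ∨ (z ∈ w ∧ z ≠ a.castSucc)
  | [], _, h, _ => by simp at h
  | x :: w, h, h1, h2 => by
    rw [List.pairwise_cons] at h
    have hp := (phi_eps_of_decreasing a h.2).1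
    have hx : x ∉ w := fun hx => lt_irrefl _ (h.1 x hx)
    have hlt := Fin.castSucc_lt_succ (i := a)
    simp only [List.mem_cons, not_or] at h1 h2
    by_cases hxa : x = a.castSucc
    · subst hxa
      refine ⟨a.succ :: w, ?_, ?_, ?_⟩
      · simp [f, hp, hx, letterF]
      · rw [List.pairwise_cons]
        exact ⟨fun z hz => (h.1 z hz).trans hlt, h.2⟩
      · intro z
        simp only [List.mem_cons]
        constructor
        · rintro (rfl | hz)
          · exact Or.inl rfl
          · exact Or.inr ⟨Or.inr hz, fun h => hx (h ▸ hz)⟩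
        · rintro (rfl | ⟨hz | hz, hz'⟩)
          · exact Or.inl rfl
          · exact absurd hz hz'
          · exact Or.inr hz
    · have haw := h1.resolve_left (Ne.symm hxa)
      obtain ⟨v, hv, hvp, hvm⟩ := f_of_decreasing a h.2 haw h2.2
      have hax : a.succ < x := by
        have h3 := h.1 _ haw
        refine lt_of_le_of_ne ?_ h2.1
        rw [gt_iff_lt, Fin.lt_def, Fin.val_castSucc] at h3
        rw [Fin.le_def, Fin.val_succ]
        exact h3
      refine ⟨x :: v, ?_, ?_, ?_⟩
      · simp [f, hp, haw, h2.2, letterEps, Ne.symm h2.1, hv]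
      · rw [List.pairwise_cons]
        refine ⟨fun z hz => ?_, hvp⟩
        rcases (hvm z).1 hz with rfl | hz'
        · exact hax
        · exact h.1 z hz'.1
      · intro z
        simp only [List.mem_cons, hvm]
        constructor
        · rintro (rfl | rfl | ⟨hz, hz'⟩)
          · exact Or.inr ⟨Or.inl rfl, hxa⟩
          · exact Or.inl rfl
          · exact Or.inr ⟨Or.inr hz, hz'⟩
        · rintro (rfl | ⟨rfl | hz, hz'⟩)
          · exact Or.inr (Or.inl rfl)
          · exact Or.inl rfl
          · exact Or.inr (Or.inr ⟨hz, hz'⟩)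

/-- The column of length `n - 1` that omits the letter `y`. -/
def columnOmit {r : ℕ} (y : Fin (r + 1)) : Word r :=
  ((List.finRange (r + 1)).filter (fun x => x ≠ y)).reverse

theorem pairwise_columnOmit {r : ℕ} (y : Fin (r + 1)) :
    (columnOmit y).Pairwise (· > ·) := by
  rw [columnOmit, List.pairwise_reverse]
  exact (List.pairwise_lt_finRange _).filter _

theorem mem_columnOmit {r : ℕ} {x y : Fin (r + 1)} : x ∈ columnOmit y ↔ x ≠ y := by
  simp [columnOmit]

theorem phi_columnOmit {r : ℕ} (a : Fin r) (y : Fin (r + 1)) :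
    phi a (columnOmit y) = if y = a.succ then 1 else 0 := by
  have hlt := (Fin.castSucc_lt_succ (i := a)).ne
  rw [(phi_eps_of_decreasing a (pairwise_columnOmit y)).1]
  simp only [mem_columnOmit, not_not]
  congr 1
  rw [eq_iff_iff]
  exact ⟨fun h => h.2.symm, fun h => ⟨h ▸ hlt, h.symm⟩⟩

theorem eps_columnOmit {r : ℕ} (a : Fin r) (y : Fin (r + 1)) :
    eps a (columnOmit y) = if y = a.castSucc then 1 else 0 := by
  have hlt := (Fin.castSucc_lt_succ (i := a)).ne'
  rw [(phi_eps_of_decreasing a (pairwise_columnOmit y)).2]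
  simp only [mem_columnOmit, not_not]
  congr 1
  rw [eq_iff_iff]
  exact ⟨fun h => h.2.symm, fun h => ⟨h ▸ hlt, h.symm⟩⟩

theorem f_columnOmit {r : ℕ} (a : Fin r) :
    f a (columnOmit a.succ) = some (columnOmit a.castSucc) := by
  have hlt := (Fin.castSucc_lt_succ (i := a)).ne
  obtain ⟨w, hw, hp, hm⟩ := f_of_decreasing a (pairwise_columnOmit a.succ)
    (mem_columnOmit.2 hlt) (fun h => mem_columnOmit.1 h rfl)
  rw [hw, Option.some.injEq]
  refine List.Pairwise.eq_of_mem_iff hp (pairwise_columnOmit _) fun z => ?_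
  rw [hm, mem_columnOmit, mem_columnOmit]
  constructor
  · rintro (rfl | h)
    · exact hlt.symm
    · exact h.2
  · intro h
    by_cases hz : z = a.succ
    · exact Or.inl hz
    · exact Or.inr ⟨hz, h⟩

/-- The word of weight `e_x - e_y` in the tensor product of the standard crystal and its dual. -/
def adjointWord {r : ℕ} (s : Fin (r + 1) × Fin (r + 1)) : Word r := s.1 :: columnOmit s.2

theorem highest_theta {r : ℕ} (hr : 0 < r) :
    highest (theta r) = adjointWord ((0 : Fin (r + 1)), Fin.last r) := by
  obtain ⟨m, rfl⟩ := Nat.exists_eq_add_one.2 hr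
  have h0 : column (0 : Fin (m + 1)) = [0] := by
    rw [column, List.finRange_succ]
    simp
  have h1 : column (Fin.last m) = columnOmit (Fin.last (m + 1)) := by
    unfold column columnOmit
    congr 2
    funext x
    have := x.2
    simp only [Fin.le_def, Fin.ext_iff, ne_eq, Fin.val_castSucc, Fin.val_last, decide_eq_decide]
    omega
  have hmid : ∀ (l : List (Fin (m + 1))), (∀ a ∈ l, (a : ℕ) ≠ 0 ∧ (a : ℕ) ≠ m) →
      l.flatMap (fun a => (List.replicate (theta (m + 1) a) (column a)).flatten) = [] := by
    intro l hl
    rw [List.flatMap_eq_nil_iff]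
    intro a ha
    have := hl a ha
    simp [theta, this.1, this.2]
  rw [highest, adjointWord, ← h1]
  -- For `n = 2` the two end nodes coincide: `θ = 2 ω_1`, and both tensor factors come from the same
  -- summand.
  cases m with
  | zero =>
    have : column (Fin.last 0) = [0] := h0
    rw [this]
    simp [List.finRange_succ, h0, theta]
  | succ m =>
    rw [List.finRange_succ_last, List.finRange_succ, List.map_cons, List.flatMap_append,
      List.flatMap_cons, hmid]
    · simp [theta, h0]
    · intro a ha
      simp only [List.map_map, List.mem_map, Function.comp] at ha
      obtain ⟨b, -, rfl⟩ := ha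
      have := b.2
      simp
      omega

/-- The truncated difference vanishes for `x = y = c.succ`; this is why `stepState` requires `s.1 ≠
s.2` for the second kind of move. -/
theorem eps_adjointWord {r : ℕ} (c : Fin r) (x y : Fin (r + 1)) :
    eps c (adjointWord (x, y)) = (if y = c.castSucc then 1 else 0) +
      ((if x = c.succ then 1 else 0) - (if y = c.succ then 1 else 0)) := by
  simp [adjointWord, eps, eps_columnOmit, phi_columnOmit, letterEps]

theorem phi_adjointWord {r : ℕ} (c : Fin r) (x y : Fin (r + 1)) :
    phi c (adjointWord (x, y)) = (if x = c.castSucc then 1 else 0) +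
      ((if y = c.succ then 1 else 0) - (if x = c.succ then 1 else 0)) := by
  simp [adjointWord, phi, phi_columnOmit, letterEps, letterPhi]

theorem wordWeight_adjointWord_self {r : ℕ} (c : Fin r) (x : Fin (r + 1)) :
    wordWeight c (adjointWord (x, x)) = 0 := by
  simp [wordWeight, eps_adjointWord, phi_adjointWord]

theorem wordWeight_highest_theta {r : ℕ} (hr : 0 < r) (c : Fin r) :
    wordWeight c (highest (theta r)) = theta r c := by
  have hc := c.2
  rw [highest_theta hr, wordWeight, eps_adjointWord, phi_adjointWord, theta]
  simp only [Fin.ext_iff, Fin.val_castSucc, Fin.val_succ, Fin.val_last, Fin.val_zero]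
  rw [if_neg (show ¬ 0 = (c : ℕ) + 1 by omega), if_neg (show ¬ r = (c : ℕ) by omega)]
  split_ifs <;> omega

section

/-! ### The raising path of an element of weight zero -/

/-- The effect of `e_c` on the words `adjointWord s`. -/
def stepState {r : ℕ} (c : Fin r) (s : Fin (r + 1) × Fin (r + 1)) :
    Option (Fin (r + 1) × Fin (r + 1)) :=
  if s.2 = c.castSucc then some (s.1, c.succ)
  else if s.1 = c.succ ∧ s.1 ≠ s.2 then some (c.castSucc, s.2) else none

/-- The state that is reached from `s` along the word `i`. -/
def finalState {r : ℕ} : List (Fin r) → Fin (r + 1) × Fin (r + 1) → Fin (r + 1) × Fin (r + 1)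
  | [], s => s
  | c :: i, s => finalState i ((stepState c s).getD s)

/-- The indicator of the positions of `i` at which the state changes. -/
def digits {r : ℕ} : List (Fin r) → Fin (r + 1) × Fin (r + 1) → List ℕ
  | [], _ => []
  | c :: i, s => (if (stepState c s).isSome then 1 else 0) :: digits i ((stepState c s).getD s)

/-- The states of the highest root, of the other positive roots and of the elements `z_k`. -/
def ValidState {r : ℕ} (s : Fin (r + 1) × Fin (r + 1)) : Prop :=
  s.1 < s.2 ∨ (s.1 = s.2 ∧ s.2 ≠ Fin.last r)

variable {r : ℕ} {c : Fin r} {s s' : Fin (r + 1) × Fin (r + 1)}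

theorem stepState_eq_some (h : stepState c s = some s') :
    (s.2 = c.castSucc ∧ s' = (s.1, c.succ)) ∨
      (s.2 ≠ c.castSucc ∧ s.1 = c.succ ∧ s.1 ≠ s.2 ∧ s' = (c.castSucc, s.2)) := by
  unfold stepState at h
  split_ifs at h with h1 h2
  · exact Or.inl ⟨h1, (Option.some.inj h).symm⟩
  · exact Or.inr ⟨h1, h2.1, h2.2, (Option.some.inj h).symm⟩

theorem stepState_eq_none (h : stepState c s = none) :
    s.2 ≠ c.castSucc ∧ (s.1 = c.succ → s.1 = s.2) := by
  unfold stepState at h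
  split_ifs at h with h1 h2
  exact ⟨h1, fun h3 => by_contra fun h4 => h2 ⟨h3, h4⟩⟩

/-- The components only move apart: a path leaves the diagonal with its first move and never
returns. -/
theorem lt_of_stepState (hs : ValidState s) (h : stepState c s = some s') : s'.1 < s'.2 := by
  have hlt := Fin.castSucc_lt_succ (i := c)
  have hle : s.1 ≤ s.2 := by
    rcases hs with h | h
    · exact h.le
    · exact h.1.le
  rcases stepState_eq_some h with ⟨h1, rfl⟩ | ⟨-, h2, -, rfl⟩
  · exact (hle.trans h1.le).trans_lt hlt
  · exact (hlt.trans_le h2.ge).trans_le hle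

theorem ValidState.step (hs : ValidState s) (c : Fin r) :
    ValidState ((stepState c s).getD s) := by
  cases h : stepState c s with
  | none => exact hs
  | some s' => exact Or.inl (lt_of_stepState hs h)

theorem length_digits : ∀ (i : List (Fin r)) (s : Fin (r + 1) × Fin (r + 1)),
    (digits i s).length = i.length
  | [], _ => rfl
  | c :: i, s => by simp [digits, length_digits i]

theorem f_adjointWord_of_stepState (hs : ValidState s) (h : stepState c s = some s') :
    f c (adjointWord s') = some (adjointWord s) := by
  have hlt := Fin.castSucc_lt_succ (i := c)
  obtain ⟨x, y⟩ := s
  rcases stepState_eq_some h with ⟨h1, rfl⟩ | ⟨h1, h2, h3, rfl⟩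
  · simp only at h1
    subst h1
    have hx : x ≠ c.succ := by
      rintro rfl
      rcases hs with h | h
      · exact lt_asymm h hlt
      · exact hlt.ne' h.1
    simp [adjointWord, f, phi_columnOmit, letterEps, hx, f_columnOmit]
  · simp only at h1 h2 h3
    subst h2
    simp [adjointWord, f, phi_columnOmit, letterF, Ne.symm h3]

/-- Both reasons for a 0/1 string are here: `e_c` vanishes if the state does not move, and after a
move it cannot be applied again. -/
theorem eps_adjointWord_step (hs : ValidState s) (c : Fin r) :
    eps c (adjointWord ((stepState c s).getD s)) = 0 := by
  have hlt := Fin.castSucc_lt_succ (i := c)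
  cases h : stepState c s with
  | none =>
    obtain ⟨h1, h2⟩ := stepState_eq_none h
    obtain ⟨x, y⟩ := s
    simp only at h1 h2
    rw [Option.getD_none, eps_adjointWord, if_neg h1]
    by_cases hx : x = c.succ
    · simp [hx, ← h2 hx]
    · simp [hx]
  | some s' =>
    have h3 := lt_of_stepState hs h
    rcases stepState_eq_some h with ⟨-, rfl⟩ | ⟨-, -, -, rfl⟩
    · simp only [Option.getD_some, eps_adjointWord, hlt.ne', if_false, if_true, zero_add]
      split_ifs <;> rfl
    · simp [eps_adjointWord, hlt.ne, h3.ne']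

theorem lower_zip_digits {t : Fin (r + 1) × Fin (r + 1)} :
    ∀ {i : List (Fin r)} {s : Fin (r + 1) × Fin (r + 1)}, ValidState s → finalState i s = t →
      lower (i.zip (digits i s)) (adjointWord t) = some (adjointWord s)
  | [], s, _, h => by simp [digits, lower, ← h, finalState]
  | c :: i, s, hs, h => by
    have ih := lower_zip_digits (hs.step c) h
    rw [digits, List.zip_cons_cons, lower, ih, Option.bind_some]
    cases h1 : stepState c s with
    | none => simp [fPow]
    | some s' => simpa [fPow] using f_adjointWord_of_stepState hs h1

theorem e_lower_drop_zip_digits {t : Fin (r + 1) × Fin (r + 1)} :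
    ∀ {i : List (Fin r)} {s : Fin (r + 1) × Fin (r + 1)}, ValidState s → finalState i s = t →
      ∀ p : Fin i.length,
        (lower ((i.zip (digits i s)).drop (p + 1)) (adjointWord t)).bind (e (i.get p)) = none
  | [], _, _, _, p => p.elim0
  | c :: i, s, hs, h, ⟨0, _⟩ => by
    have h1 := lower_zip_digits (hs.step c) h
    simpa [digits, h1] using e_eq_none_iff.2 (eps_adjointWord_step hs c)
  | c :: i, s, hs, h, ⟨p + 1, hp⟩ => by
    have h1 := e_lower_drop_zip_digits (hs.step c) h ⟨p, Nat.lt_of_succ_lt_succ hp⟩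
    simpa [digits] using h1

/-- The function on the positions of `i` that is given by `digits i s`. -/
def digitFun (i : List (Fin r)) (s : Fin (r + 1) × Fin (r + 1)) (p : Fin i.length) : ℕ :=
  (digits i s)[p]'(by rw [length_digits]; exact p.2)

theorem pairs_digitFun (i : List (Fin r)) (s : Fin (r + 1) × Fin (r + 1)) :
    pairs i (digitFun i s) = i.zip (digits i s) := by
  refine List.ext_getElem (by simp [pairs, length_digits]) fun p h1 h2 => ?_
  simp [pairs, digitFun]

theorem ofFn_digitFun (i : List (Fin r)) (s : Fin (r + 1) × Fin (r + 1)) :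
    List.ofFn (digitFun i s) = digits i s := by
  refine List.ext_getElem (by simp [length_digits]) fun p h1 h2 => ?_
  simp [digitFun]

theorem isStringOf_digitFun (hr : 0 < r) {i : List (Fin r)} (hs : ValidState s)
    (h : finalState i s = (0, Fin.last r)) :
    IsStringOf i (theta r) (some (adjointWord s)) (digitFun i s) := by
  unfold IsStringOf IsAdapted
  rw [highest_theta hr, pairs_digitFun]
  have h1 := lower_zip_digits hs h
  exact ⟨⟨by simp [h1], e_lower_drop_zip_digits hs h⟩, h1⟩

theorem isStringOf_iff_eq_digitFun (hr : 0 < r) {i : List (Fin r)} (hs : ValidState s)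
    (h : finalState i s = (0, Fin.last r)) (x : Fin i.length → ℕ) :
    IsStringOf i (theta r) (some (adjointWord s)) x ↔ x = digitFun i s := by
  have h1 := isStringOf_digitFun hr hs h
  constructor
  · intro h2
    obtain ⟨B, hB⟩ := h1.1.exists_isPath
    obtain ⟨B', hB'⟩ := h2.1.exists_isPath
    refine hB'.unique hB ?_
    rw [← Option.some.injEq, ← hB.zero, ← hB'.zero, h1.2, h2.2]
  · rintro rfl
    exact h1

/-! ### The remaining word of the greedy search -/

/-- The letters from `b` upwards, in increasing order. -/
def lettersFrom (b : Fin (r + 1)) : List (Fin r) :=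
  (List.finRange r).filter (fun c => b ≤ c.castSucc)

/-- The letters below `a`, in decreasing order. -/
def lettersBelow (a : Fin (r + 1)) : List (Fin r) :=
  ((List.finRange r).filter (fun c => c.castSucc < a)).reverse

theorem mem_lettersFrom {b : Fin (r + 1)} : c ∈ lettersFrom b ↔ b ≤ c.castSucc := by
  simp [lettersFrom]

theorem mem_lettersBelow {a : Fin (r + 1)} : c ∈ lettersBelow a ↔ c.castSucc < a := by
  simp [lettersBelow]

theorem pairwise_lettersFrom (b : Fin (r + 1)) : (lettersFrom b).Pairwise (· < ·) :=
  (List.pairwise_lt_finRange _).filter _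

theorem pairwise_lettersBelow (a : Fin (r + 1)) : (lettersBelow a).Pairwise (· > ·) := by
  rw [lettersBelow, List.pairwise_reverse]
  exact (List.pairwise_lt_finRange _).filter _

theorem lettersFrom_castSucc (c : Fin r) :
    lettersFrom c.castSucc = c :: lettersFrom c.succ := by
  refine List.Pairwise.eq_of_mem_iff (pairwise_lettersFrom _)
    (List.pairwise_cons.2 ⟨fun d hd => ?_, pairwise_lettersFrom _⟩) fun d => ?_
  · rw [mem_lettersFrom, Fin.le_def, Fin.val_succ, Fin.val_castSucc] at hd
    exact Fin.lt_def.2 hd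
  · simp only [List.mem_cons, mem_lettersFrom, Fin.le_def, Fin.val_succ, Fin.val_castSucc,
      Fin.ext_iff]
    omega

theorem lettersBelow_succ (c : Fin r) :
    lettersBelow c.succ = c :: lettersBelow c.castSucc := by
  refine List.Pairwise.eq_of_mem_iff (pairwise_lettersBelow _)
    (List.pairwise_cons.2 ⟨fun d hd => ?_, pairwise_lettersBelow _⟩) fun d => ?_
  · rw [mem_lettersBelow, Fin.castSucc_lt_castSucc_iff] at hd
    exact hd
  · simp only [List.mem_cons, mem_lettersBelow, Fin.lt_def, Fin.val_succ, Fin.val_castSucc,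
      Fin.ext_iff]
    omega

theorem lettersFrom_eq_nil_iff {b : Fin (r + 1)} : lettersFrom b = [] ↔ b = Fin.last r := by
  constructor
  · intro h
    refine Fin.lastCases (fun _ => rfl) (fun c h => ?_) b h
    simp [lettersFrom_castSucc] at h
  · rintro rfl
    rw [List.eq_nil_iff_forall_not_mem]
    intro c hc
    rw [mem_lettersFrom] at hc
    exact absurd (Fin.castSucc_lt_last c) (not_lt.2 hc)

theorem lettersBelow_eq_nil_iff {a : Fin (r + 1)} : lettersBelow a = [] ↔ a = 0 := by
  constructor
  · intro h
    refine Fin.cases (fun _ => rfl) (fun c h => ?_) a h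
    simp [lettersBelow_succ] at h
  · rintro rfl
    rw [List.eq_nil_iff_forall_not_mem]
    intro c hc
    rw [mem_lettersBelow] at hc
    exact absurd hc (Fin.not_lt_zero _)

/-- What remains of the word of `z_k` in the state `s`. -/
def remaining (s : Fin (r + 1) × Fin (r + 1)) : List (Fin r) :=
  lettersFrom s.2 ++ lettersBelow s.1

theorem remaining_eq_nil_iff : remaining s = [] ↔ s = (0, Fin.last r) := by
  obtain ⟨a, b⟩ := s
  simp only [remaining, List.append_eq_nil_iff, lettersFrom_eq_nil_iff, lettersBelow_eq_nil_iff,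
    Prod.mk.injEq]
  exact and_comm

theorem remaining_self (k : Fin r) : remaining (k.castSucc, k.castSucc) = zWord k := by
  simp [remaining, lettersFrom, lettersBelow, zWord]

theorem lower_remaining (hs : ValidState s) :
    lower ((remaining s).map (fun a => (a, 1))) (adjointWord ((0 : Fin (r + 1)), Fin.last r)) =
      some (adjointWord s) := by
  have key : ∀ (n : ℕ) (s : Fin (r + 1) × Fin (r + 1)), (remaining s).length = n →
      ValidState s →
      lower ((remaining s).map (fun a => (a, 1))) (adjointWord ((0 : Fin (r + 1)), Fin.last r)) =
        some (adjointWord s) := by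
    intro n
    induction n with
    | zero =>
      intro s hn hs
      rw [List.length_eq_zero_iff, remaining_eq_nil_iff] at hn
      simp [hn, lower, remaining_eq_nil_iff.2]
    | succ n ih =>
      intro s hn hs
      -- The first remaining letter raises the second component until it reaches the top; only then
      -- is the first component lowered.
      have hex : ∃ c s', stepState c s = some s' ∧ remaining s = c :: remaining s' := by
        obtain ⟨a, b⟩ := s
        induction b using Fin.lastCases with
        | cast c =>
          exact ⟨c, (a, c.succ), by simp [stepState], by simp [remaining, lettersFrom_castSucc]⟩
        | last =>
          have hal : a ≠ Fin.last r := by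
            rcases hs with h | h
            · exact h.ne
            · exact absurd rfl h.2
          induction a using Fin.cases with
          | zero => rw [remaining_eq_nil_iff.2 rfl] at hn; simp at hn
          | succ c =>
            refine ⟨c, (c.castSucc, Fin.last r), ?_, ?_⟩
            · simp [stepState, hal, (Fin.castSucc_lt_last c).ne']
            · simp [remaining, lettersBelow_succ, lettersFrom_eq_nil_iff.2]
      obtain ⟨c, s', hc, hrem⟩ := hex
      have ih' := ih s' (by rw [hrem, List.length_cons] at hn; omega)
        (Or.inl (lt_of_stepState hs hc))
      rw [hrem, List.map_cons, lower, ih']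
      simpa [fPow] using f_adjointWord_of_stepState hs hc
  exact key _ s rfl hs

theorem validState_self (k : Fin r) : ValidState (k.castSucc, k.castSucc) :=
  Or.inr ⟨rfl, (Fin.castSucc_lt_last k).ne⟩

theorem zElt_eq (hr : 0 < r) (k : Fin r) :
    zElt k = some (adjointWord (k.castSucc, k.castSucc)) := by
  rw [zElt, highest_theta hr, ← remaining_self, lower_remaining (validState_self k)]

theorem canLead_cons {d : Fin r} {u : List (Fin r)} :
    CanLead c (d :: u) ↔ c = d ∨ (((c : ℕ) + 2 ≤ d ∨ (d : ℕ) + 2 ≤ c) ∧ CanLead c u) := by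
  unfold CanLead
  by_cases h : c = d
  · subst h
    simp
  · simp only [List.mem_cons, h, false_or, List.takeWhile_cons, Ne.symm h, ne_eq, not_false_eq_true,
      decide_true, if_true, forall_eq_or_imp]
    tauto

/-- The letter just below `c` precedes `c` in the increasing run and does not commute with it. -/
theorem not_canLead_lettersFrom {b : Fin (r + 1)} (h : b < c.castSucc) (u : List (Fin r)) :
    ¬ CanLead c (lettersFrom b ++ u) := by
  induction b using Fin.reverseInduction with
  | last => exact absurd h (not_lt.2 (Fin.le_last _))
  | cast d ih =>
    rw [Fin.castSucc_lt_castSucc_iff] at h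
    rw [lettersFrom_castSucc, List.cons_append, canLead_cons]
    rintro (rfl | ⟨h1, h2⟩)
    · exact lt_irrefl _ h
    · refine ih ?_ h2
      rw [Fin.lt_def] at h ⊢
      rw [Fin.val_succ, Fin.val_castSucc]
      omega

/-- Either `c` does not occur, or the letter just above `c` precedes it in the decreasing run. -/
theorem not_canLead_lettersBelow {a : Fin (r + 1)} (h : a ≠ c.succ) :
    ¬ CanLead c (lettersBelow a) := by
  induction a using Fin.induction with
  | zero => simp [lettersBelow_eq_nil_iff.2, CanLead]
  | succ d ih =>
    rw [lettersBelow_succ, canLead_cons]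
    rintro (rfl | ⟨h1, h2⟩)
    · exact h rfl
    · refine ih ?_ h2
      intro h3
      rw [Fin.ext_iff, Fin.val_castSucc, Fin.val_succ] at h3
      omega

theorem CanLead.of_append {l u : List (Fin r)} (hl : c ∉ l) (h : CanLead c (l ++ u)) :
    CanLead c u := by
  induction l with
  | nil => exact h
  | cons d l ih =>
    rw [List.cons_append, canLead_cons] at h
    rw [List.mem_cons, not_or] at hl
    exact ih hl.2 (h.resolve_left hl.1).2

theorem CanLead.append {l u : List (Fin r)} (hl : ∀ d ∈ l, (c : ℕ) + 2 ≤ d)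
    (h : CanLead c u) : CanLead c (l ++ u) := by
  induction l with
  | nil => exact h
  | cons d l ih =>
    rw [List.cons_append, canLead_cons]
    rw [List.forall_mem_cons] at hl
    exact Or.inr ⟨Or.inl hl.1, ih hl.2⟩

theorem canLead_remaining_of_step (hs : ValidState s) (h : stepState c s = some s') :
    CanLead c (remaining s) ∧ (remaining s).erase c = remaining s' := by
  obtain ⟨a, b⟩ := s
  rcases stepState_eq_some h with ⟨h1, rfl⟩ | ⟨h1, h2, h3, rfl⟩
  · simp only at h1
    subst h1
    simp only [remaining, lettersFrom_castSucc, List.cons_append, canLead_cons, true_or,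
      List.erase_cons_head, true_and]
  · simp only at h1 h2 h3
    subst h2
    have hlt : c.succ < b := hs.elim id fun h => absurd h.1 h3
    rw [Fin.lt_def, Fin.val_succ] at hlt
    simp only [remaining, lettersBelow_succ]
    constructor
    · refine CanLead.append (fun d hd => ?_) (canLead_cons.2 (Or.inl rfl))
      rw [mem_lettersFrom, Fin.le_def, Fin.val_castSucc] at hd
      omega
    · rw [List.erase_append_right, List.erase_cons_head]
      rw [mem_lettersFrom, Fin.le_def, Fin.val_castSucc]
      omega

theorem not_canLead_remaining_of_step (hs : ValidState s) (h : stepState c s = none) :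
    ¬ CanLead c (remaining s) := by
  obtain ⟨a, b⟩ := s
  obtain ⟨h1, h2⟩ := stepState_eq_none h
  simp only at h1 h2
  intro hc
  rcases lt_trichotomy b c.castSucc with hb | hb | hb
  · exact not_canLead_lettersFrom hb _ hc
  · exact h1 hb
  · by_cases ha : a = c.succ
    · have hab := h2 ha
      subst hab
      induction a using Fin.lastCases with
      | last => exact hs.elim (fun h => lt_irrefl _ h) (fun h => h.2 rfl)
      | cast d =>
        rw [remaining, lettersFrom_castSucc, List.cons_append, canLead_cons] at hc
        rw [Fin.ext_iff, Fin.val_castSucc, Fin.val_succ] at ha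
        rcases hc with rfl | hc
        · omega
        · omega
    · refine not_canLead_lettersBelow ha (hc.of_append ?_)
      rw [mem_lettersFrom]
      exact not_le.2 hb

theorem greedy_remaining : ∀ {i : List (Fin r)} {s : Fin (r + 1) × Fin (r + 1)},
    ValidState s → finalState i s = (0, Fin.last r) →
      greedy i (remaining s) = some (digits i s)
  | [], s, _, h => by
    have h' : remaining s = [] := remaining_eq_nil_iff.2 h
    rw [greedy, if_pos h', digits]
  | c :: i, s, hs, h => by
    have ih := greedy_remaining (hs.step c) h
    rw [greedy, digits]
    cases h1 : stepState c s with
    | none =>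
      rw [if_neg (not_canLead_remaining_of_step hs h1)]
      rw [h1] at ih
      simp at ih
      simp [ih]
    | some s' =>
      obtain ⟨h2, h3⟩ := canLead_remaining_of_step hs h1
      rw [if_pos h2, h3]
      rw [h1] at ih
      simp at ih
      simp [ih]

end

section

/-! ### Permutations and wires -/

variable {r : ℕ}

theorem permOf_cons (c : Fin r) (i : List (Fin r)) :
    permOf (c :: i) = Equiv.swap c.castSucc c.succ * permOf i := by
  simp [permOf]

theorem permOf_append (i j : List (Fin r)) : permOf (i ++ j) = permOf i * permOf j := by
  simp [permOf]

theorem permOf_take_succ (i : List (Fin r)) (p : Fin i.length) :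
    permOf (i.take (p + 1)) =
      permOf (i.take p) * Equiv.swap (i.get p).castSucc (i.get p).succ := by
  rw [List.take_succ_eq_append_getElem p.2, permOf_append]
  simp [permOf]

theorem wireAt_eq (i : List (Fin r)) (m : ℕ) (l : Fin (r + 1)) :
    wireAt i m l = permOf (i.take m) l := by
  induction m generalizing l with
  | zero => simp [wireAt, permOf]
  | succ m ih =>
    rw [wireAt]
    by_cases hm : m < i.length
    · rw [List.getElem?_eq_getElem hm]
      simp only [ih]
      rw [permOf_take_succ i ⟨m, hm⟩]
      rfl
    · rw [List.getElem?_eq_none (not_lt.1 hm)]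
      simp only [ih]
      rw [List.take_of_length_le (by omega), List.take_of_length_le (by omega)]

theorem swap_eq_of_isCrossing {i : List (Fin r)} {p : Fin i.length} {u v : Fin (r + 1)}
    (h : IsCrossing i p u v) :
    permOf (i.take p) * Equiv.swap (i.get p).castSucc (i.get p).succ =
      Equiv.swap u v * permOf (i.take p) := by
  unfold IsCrossing at h
  rw [Equiv.mul_swap_eq_swap_mul, ← wireAt_eq, ← wireAt_eq]
  rcases h with ⟨h1, h2⟩ | ⟨h1, h2⟩
  · rw [h1, h2]
  · rw [h1, h2, Equiv.swap_comm]

/-- Two wires of a reduced expression do not cross twice: both crossings could be deleted. -/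
theorem IsReducedLongest.not_isCrossing {i : List (Fin r)} (hi : IsReducedLongest i)
    {p q : Fin i.length} (hpq : p < q) {u v : Fin (r + 1)} (hp : IsCrossing i p u v) :
    ¬ IsCrossing i q u v := by
  intro hq
  have h1 := swap_eq_of_isCrossing hp
  have h2 := swap_eq_of_isCrossing hq
  rw [← permOf_take_succ] at h1 h2
  have hsplit : i.take q = i.take (p + 1) ++ (i.take q).drop (p + 1) := by
    conv_lhs => rw [← List.take_append_drop (p + 1) (i.take q)]
    rw [List.take_take, min_eq_left (Nat.succ_le_of_lt hpq)]
  have h3 : permOf (i.take p ++ (i.take q).drop (p + 1) ++ i.drop (q + 1)) = permOf i := by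
    conv_rhs => rw [← List.take_append_drop (q + 1) i]
    rw [permOf_append, permOf_append, permOf_append, h2, hsplit, permOf_append, h1]
    rw [List.drop_left' (by simp)]
    simp only [← mul_assoc, Equiv.swap_mul_self, one_mul]
  have h4 := hi.2 _ (h3.trans hi.1)
  have := q.2
  have : (p : ℕ) < q := hpq
  simp only [List.length_append, List.length_take, List.length_drop] at h4
  omega

/-- A swap of adjacent levels changes the order of two wires only if it crosses these two. Without
such a crossing `u` would stay below `v`, whereas the full word reverses all wires. -/
theorem exists_crossing {i : List (Fin r)} (hi : permOf i = Fin.revPerm) {u v : Fin (r + 1)}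
    (huv : u < v) :
    ∃ p : Fin i.length, wireAt i p (i.get p).castSucc = u ∧ wireAt i p (i.get p).succ = v := by
  by_contra hcon
  push Not at hcon
  have key : ∀ m ≤ i.length, (permOf (i.take m))⁻¹ u < (permOf (i.take m))⁻¹ v := by
    intro m
    induction m with
    | zero => intro _; simpa [permOf] using huv
    | succ m ih =>
      intro hm
      have h1 := ih (by omega)
      have h2 := hcon ⟨m, hm⟩
      simp only [wireAt_eq] at h2
      have h3 := permOf_take_succ i ⟨m, hm⟩
      simp only at h3
      rw [h3, mul_inv_rev, Equiv.swap_inv, Equiv.Perm.mul_apply, Equiv.Perm.mul_apply]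
      generalize permOf (i.take m) = σ at *
      generalize i.get ⟨m, hm⟩ = c at *
      obtain ⟨x, rfl⟩ := σ.surjective u
      obtain ⟨y, rfl⟩ := σ.surjective v
      have hinv : ∀ z, σ⁻¹ (σ z) = z := σ.symm_apply_apply
      simp only [hinv] at h1 ⊢
      have h4 : ¬ (x = c.castSucc ∧ y = c.succ) := by
        rintro ⟨rfl, rfl⟩
        exact h2 rfl rfl
      simp only [Equiv.swap_apply_def, Fin.ext_iff, Fin.lt_def, Fin.val_castSucc,
        Fin.val_succ] at h1 h4 ⊢
      split_ifs <;> (try simp only [Fin.val_castSucc, Fin.val_succ]) <;> omega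
  have h5 := key i.length le_rfl
  rw [List.take_length, hi] at h5
  have h6 : ∀ w : Fin (r + 1), (Fin.revPerm)⁻¹ w = Fin.rev w := fun _ => rfl
  rw [h6, h6, Fin.rev_lt_rev] at h5
  exact lt_asymm huv h5

theorem IsReducedLongest.existsUnique_crossing {i : List (Fin r)} (hi : IsReducedLongest i)
    {u v : Fin (r + 1)} (huv : u < v) :
    ∃ p : Fin i.length, (∀ q : Fin i.length, IsCrossing i q u v ↔ q = p) ∧
      wireAt i p (i.get p).castSucc = u ∧ wireAt i p (i.get p).succ = v := by
  obtain ⟨p, hp⟩ := exists_crossing hi.1 huv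
  have hp' : IsCrossing i p u v := Or.inl hp
  refine ⟨p, fun q => ⟨fun hq => ?_, fun hq => hq ▸ hp'⟩, hp⟩
  rcases lt_trichotomy q p with h | h | h
  · exact absurd hp' (hi.not_isCrossing h hq)
  · exact h
  · exact absurd hq (hi.not_isCrossing h hp')

/-- At each crossing the lower wire has the smaller label. -/
theorem IsReducedLongest.wireAt_lt {i : List (Fin r)} (hi : IsReducedLongest i)
    (p : Fin i.length) : wireAt i p (i.get p).castSucc < wireAt i p (i.get p).succ := by
  rcases lt_trichotomy (wireAt i p (i.get p).castSucc) (wireAt i p (i.get p).succ) with h | h | h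
  · exact h
  · rw [wireAt_eq, wireAt_eq] at h
    exact absurd ((permOf _).injective h) Fin.castSucc_lt_succ.ne
  · obtain ⟨q, hq, h1, -⟩ := hi.existsUnique_crossing h
    have h2 := (hq p).1 (Or.inr ⟨rfl, rfl⟩)
    subst h2
    exact absurd h1 h.ne'

/-! ### The final state of the raising path -/

theorem lt_swap_iff {c : Fin r} {b l : Fin (r + 1)} (h : b ≠ c.castSucc) :
    b < Equiv.swap c.castSucc c.succ l ↔ b < l := by
  rw [ne_eq, Fin.ext_iff, Fin.val_castSucc] at h
  rw [Equiv.swap_apply_def]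
  split_ifs with h1 h2
  · rw [h1, Fin.lt_def, Fin.lt_def, Fin.val_castSucc, Fin.val_succ]
    omega
  · rw [h2, Fin.lt_def, Fin.lt_def, Fin.val_castSucc, Fin.val_succ]
    omega
  · rfl

theorem swap_lt_iff {c : Fin r} {a l : Fin (r + 1)} (h : a ≠ c.succ) :
    Equiv.swap c.castSucc c.succ l < a ↔ l < a := by
  rw [ne_eq, Fin.ext_iff, Fin.val_succ] at h
  rw [Equiv.swap_apply_def]
  split_ifs with h1 h2
  · rw [h1, Fin.lt_def, Fin.lt_def, Fin.val_castSucc, Fin.val_succ]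
    omega
  · rw [h2, Fin.lt_def, Fin.lt_def, Fin.val_castSucc, Fin.val_succ]
    omega
  · rfl

/-- The wires up to `k` are below level `s.2` and the wires above `k` are not below level `s.1`,
where `σ` maps levels to wires. -/
def LevelInvariant (k : Fin r) (σ : Equiv.Perm (Fin (r + 1)))
    (s : Fin (r + 1) × Fin (r + 1)) : Prop :=
  ValidState s ∧ (∀ l, s.2 < l → k.castSucc < σ l) ∧
    ∀ l, (l < s.1 ∨ (s.1 = s.2 ∧ l = s.1)) → σ l ≤ k.castSucc

/-- If the state stays, the swap preserves both sets of levels that the invariant constrains. If it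
moves, the new sets of levels avoid the two that are swapped. -/
theorem LevelInvariant.step {k : Fin r} {σ : Equiv.Perm (Fin (r + 1))}
    {s : Fin (r + 1) × Fin (r + 1)} (h : LevelInvariant k σ s) (c : Fin r) :
    LevelInvariant k (σ * Equiv.swap c.castSucc c.succ) ((stepState c s).getD s) := by
  obtain ⟨hs, h1, h2⟩ := h
  have hle : s.1 ≤ s.2 := by
    rcases hs with h | h
    · exact h.le
    · exact h.1.le
  refine ⟨hs.step c, ?_⟩
  obtain ⟨a, b⟩ := s
  cases hc : stepState c (a, b) with
  | none =>
    obtain ⟨h3, h4⟩ := stepState_eq_none hc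
    simp only [Option.getD_none, Equiv.Perm.mul_apply] at h1 h2 h3 h4 hle ⊢
    refine ⟨fun l hl => h1 _ ((lt_swap_iff h3).2 hl), fun l hl => h2 _ ?_⟩
    by_cases hab : a = b
    · have hl' : ¬ b < l := hab ▸ not_lt.2 (hl.elim le_of_lt fun h => h.2.le)
      rw [← lt_swap_iff h3, not_lt, ← hab] at hl'
      exact hl'.lt_or_eq.imp_right fun h => ⟨hab, h⟩
    · exact Or.inl ((swap_lt_iff fun h => hab (h4 h)).2 (hl.resolve_right fun h => hab h.1))
  | some s' =>
    have h5 := lt_of_stepState hs hc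
    simp only [Option.getD_some, Equiv.Perm.mul_apply, h5.ne, false_and, or_false]
    rcases stepState_eq_some hc with ⟨h3, rfl⟩ | ⟨h3, h4, h6, rfl⟩
    · simp only at h1 h2 h3 hle ⊢
      subst h3
      refine ⟨fun l hl => ?_, fun l hl => ?_⟩
      · rw [Equiv.swap_apply_of_ne_of_ne (Fin.castSucc_lt_succ.trans hl).ne' hl.ne']
        exact h1 l (Fin.castSucc_lt_succ.trans hl)
      · have h7 := hl.trans_le hle
        rw [Equiv.swap_apply_of_ne_of_ne h7.ne (h7.trans Fin.castSucc_lt_succ).ne]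
        exact h2 l (Or.inl hl)
    · simp only at h1 h2 h4 h6 hle ⊢
      subst h4
      refine ⟨fun l hl => ?_, fun l hl => ?_⟩
      · have h7 := hle.trans_lt hl
        rw [Equiv.swap_apply_of_ne_of_ne (Fin.castSucc_lt_succ.trans h7).ne' h7.ne']
        exact h1 l hl
      · have h7 := hl.trans (Fin.castSucc_lt_succ (i := c))
        rw [Equiv.swap_apply_of_ne_of_ne hl.ne h7.ne]
        exact h2 l (Or.inl h7)

theorem LevelInvariant.finalState {k : Fin r} : ∀ (i : List (Fin r))
    {σ : Equiv.Perm (Fin (r + 1))} {s : Fin (r + 1) × Fin (r + 1)}, LevelInvariant k σ s →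
      LevelInvariant k (σ * permOf i) (finalState i s)
  | [], σ, s, h => by simpa [permOf, StringCrystal.finalState] using h
  | c :: i, σ, s, h => by
    rw [permOf_cons, ← mul_assoc]
    exact LevelInvariant.finalState i (h.step c)

theorem finalState_eq {i : List (Fin r)} (hi : permOf i = Fin.revPerm) (k : Fin r) :
    finalState i (k.castSucc, k.castSucc) = (0, Fin.last r) := by
  have h0 : LevelInvariant k 1 (k.castSucc, k.castSucc) := by
    refine ⟨validState_self k, fun l hl => hl, ?_⟩
    rintro l (hl | hl)
    · exact hl.le
    · exact hl.2.le
  have h := h0.finalState i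
  rw [one_mul, hi] at h
  obtain ⟨hs, h1, h2⟩ := h
  generalize finalState i (k.castSucc, k.castSucc) = s at *
  obtain ⟨a, b⟩ := s
  simp only [Fin.revPerm_apply] at h1 h2
  -- The reversal puts the lowest wire on the top level and the highest wire on the bottom level.
  -- Any other state would require a wire above `k` on top or a wire up to `k` at the bottom.
  have hb : b = Fin.last r := by
    by_contra hb
    have h3 := h1 _ (Fin.lt_last_iff_ne_last.2 hb)
    rw [Fin.rev_last] at h3
    exact absurd h3 (Fin.not_lt_zero _)
  have ha : a = 0 := by
    by_contra ha
    have h3 := h2 0 (Or.inl (Fin.pos_iff_ne_zero.2 ha))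
    rw [Fin.rev_zero] at h3
    exact absurd h3 (not_le.2 (Fin.castSucc_lt_last k))
  rw [ha, hb]

theorem finalState_append (i j : List (Fin r)) (s : Fin (r + 1) × Fin (r + 1)) :
    finalState (i ++ j) s = finalState j (finalState i s) := by
  induction i generalizing s with
  | nil => rfl
  | cons c i ih => exact ih _

theorem finalState_take_succ (i : List (Fin r)) (s : Fin (r + 1) × Fin (r + 1))
    (p : Fin i.length) : finalState (i.take (p + 1)) s =
      (stepState (i.get p) (finalState (i.take p) s)).getD (finalState (i.take p) s) := by
  rw [List.take_succ_eq_append_getElem p.2, finalState_append]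
  rfl

theorem digitFun_eq : ∀ (i : List (Fin r)) (s : Fin (r + 1) × Fin (r + 1)) (p : Fin i.length),
    digitFun i s p = if (stepState (i.get p) (finalState (i.take p) s)).isSome then 1 else 0
  | [], _, p => p.elim0
  | c :: i, s, ⟨0, _⟩ => by simp [digitFun, digits, finalState]
  | c :: i, s, ⟨p + 1, hp⟩ => by
    have h := digitFun_eq i ((stepState c s).getD s) ⟨p, Nat.lt_of_succ_lt_succ hp⟩
    simpa [digitFun, digits, finalState] using h

/-! ### The strings of `z_1` and `z_{n-1}` on the wiring diagram -/

theorem digitFun_bottom {i : List (Fin r)} (hi : IsReducedLongest i) (p : Fin i.length) :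
    digitFun i (0, 0) p = if wireAt i p (i.get p).castSucc = 0 then 1 else 0 := by
  -- The second component is the level of the bottom wire, which can only go up, since it is the
  -- lower wire at each of its crossings.
  have key : ∀ m ≤ i.length, (finalState (i.take m) (0, 0)).1 = 0 ∧
      wireAt i m (finalState (i.take m) (0, 0)).2 = 0 := by
    intro m
    induction m with
    | zero => intro _; simp [finalState, wireAt]
    | succ m ih =>
      intro hm
      have h1 := ih (by omega)
      have h2 := hi.wireAt_lt ⟨m, hm⟩
      have h3 := permOf_take_succ i ⟨m, hm⟩
      have h4 := finalState_take_succ i (0, 0) ⟨m, hm⟩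
      simp only [wireAt_eq] at h1 h2 h3 h4 ⊢
      rw [h4, h3]
      generalize finalState (i.take m) (0, 0) = s at *
      generalize permOf (i.take m) = σ at *
      generalize i.get ⟨m, hm⟩ = c at *
      obtain ⟨a, b⟩ := s
      obtain ⟨rfl, h1⟩ := h1
      by_cases hb : b = c.castSucc
      · simp [stepState, hb, ← h1]
      · have hb' : b ≠ c.succ := by
          rintro rfl
          simp only at h1
          rw [h1] at h2
          exact absurd h2 (Fin.not_lt_zero _)
        simpa [stepState, hb, (Fin.succ_ne_zero c).symm,
          Equiv.swap_apply_of_ne_of_ne hb hb'] using h1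
  obtain ⟨h1, h2⟩ := key p p.2.le
  rw [digitFun_eq]
  have hiff : (stepState (i.get p) (finalState (i.take p) (0, 0))).isSome ↔
      (finalState (i.take p) (0, 0)).2 = (i.get p).castSucc := by
    unfold stepState
    rw [h1]
    simp only [(Fin.succ_ne_zero _).symm, false_and, if_false]
    split_ifs with h
    · simp [h]
    · simpa using h
  simp only [hiff]
  congr 1
  rw [eq_iff_iff]
  constructor
  · intro h
    rw [← h, h2]
  · intro h
    apply (permOf (i.take p)).injective
    rw [← wireAt_eq, ← wireAt_eq, h, h2]

theorem digitFun_top {i : List (Fin r)} (hi : IsReducedLongest i) {k : Fin r}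
    (hk : k.succ = Fin.last r) (p : Fin i.length) :
    digitFun i (k.castSucc, k.castSucc) p =
      if wireAt i p (i.get p).succ = Fin.last r then 1 else 0 := by
  have hstep : ∀ (c : Fin r) (s : Fin (r + 1) × Fin (r + 1)) (l : Fin (r + 1)),
      l ≠ c.castSucc →
      (s = (k.castSucc, k.castSucc) ∧ l = Fin.last r ∨ s = (l, Fin.last r) ∧ l ≠ Fin.last r) →
      stepState c s = if l = c.succ then some (c.castSucc, Fin.last r) else none := by
    rintro c s l hl (⟨rfl, rfl⟩ | ⟨rfl, h⟩)
    · rw [← hk]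
      by_cases hck : k = c
      · simp [stepState, hck]
      · simp [stepState, hck]
    · simp [stepState, (Fin.castSucc_lt_last c).ne', h]
  -- Here `l` is the level of the top wire. Its first descent is a move of the second component of
  -- the state; from then on the first component equals `l`.
  have key : ∀ m ≤ i.length, ∃ l, wireAt i m l = Fin.last r ∧
      (finalState (i.take m) (k.castSucc, k.castSucc) = (k.castSucc, k.castSucc) ∧
        l = Fin.last r ∨
      finalState (i.take m) (k.castSucc, k.castSucc) = (l, Fin.last r) ∧ l ≠ Fin.last r) := by
    intro m
    induction m with
    | zero => intro _; exact ⟨Fin.last r, rfl, Or.inl ⟨rfl, rfl⟩⟩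
    | succ m ih =>
      intro hm
      obtain ⟨l, h1, h5⟩ := ih (by omega)
      have h2 := hi.wireAt_lt ⟨m, hm⟩
      have h3 := permOf_take_succ i ⟨m, hm⟩
      have h4 := finalState_take_succ i (k.castSucc, k.castSucc) ⟨m, hm⟩
      simp only [wireAt_eq] at h1 h2 h3 h4 ⊢
      rw [h4, h3]
      generalize finalState (i.take m) (k.castSucc, k.castSucc) = s at *
      generalize permOf (i.take m) = σ at *
      generalize i.get ⟨m, hm⟩ = c at *
      have hl : l ≠ c.castSucc := by
        rintro rfl
        rw [h1] at h2
        exact absurd h2 (not_lt.2 (Fin.le_last _))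
      rw [hstep c s l hl h5]
      by_cases hlc : l = c.succ
      · refine ⟨c.castSucc, ?_, Or.inr ⟨?_, (Fin.castSucc_lt_last c).ne⟩⟩
        · rw [Equiv.Perm.mul_apply, Equiv.swap_apply_left, ← hlc, h1]
        · rw [if_pos hlc, Option.getD_some]
      · refine ⟨l, ?_, ?_⟩
        · rw [Equiv.Perm.mul_apply, Equiv.swap_apply_of_ne_of_ne hl hlc, h1]
        · rwa [if_neg hlc, Option.getD_none]
  obtain ⟨l, h1, h5⟩ := key p p.2.le
  have h2 := hi.wireAt_lt p
  have hl : l ≠ (i.get p).castSucc := by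
    rintro rfl
    rw [h1] at h2
    exact absurd h2 (not_lt.2 (Fin.le_last _))
  rw [digitFun_eq, hstep _ _ l hl h5]
  congr 1
  rw [eq_iff_iff, ← h1, wireAt_eq, wireAt_eq, (permOf _).injective.eq_iff]
  rw [eq_comm (a := (i.get p).succ)]
  split_ifs with h
  · simp [h]
  · simp only [Option.isSome_none, Bool.false_eq_true, false_iff]
    exact h

end

/-! ### Lattice points of weight zero -/

variable {r : ℕ} {i : List (Fin r)}

/-- A solution of the linear system of the Cartan matrix whose right hand side is `θ`. -/
theorem eq_one_of_cartan {M : ℕ → ℤ} (h0 : M 0 = 0) (hr1 : M (r + 1) = 0)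
    (h : ∀ n, n < r → 2 * M (n + 1) - M n - M (n + 2) =
      (if n = 0 then 1 else 0) + (if n + 1 = r then 1 else 0)) :
    ∀ n, n < r → M (n + 1) = 1 := by
  -- Away from the end nodes the equations say that `M` is affine. The source at the first node
  -- makes the line pass through `1` at `n = 0`, although `M 0 = 0`.
  have hlin : ∀ n, n < r → M (n + 1) = 1 + (n + 1) * (M 1 - 1) ∧
      M n = if n = 0 then 0 else 1 + n * (M 1 - 1) := by
    intro n
    induction n with
    | zero => intro _; simp [h0]
    | succ n ih =>
      intro hn
      obtain ⟨h1, h2⟩ := ih (by omega)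
      have h3 := h n (by omega)
      rw [if_neg (show ¬ n + 1 = r by omega)] at h3
      refine ⟨?_, by simp [h1]⟩
      have h4 : M (n + 1 + 1) = 2 * M (n + 1) - M n - if n = 0 then 1 else 0 := by
        have : M (n + 1 + 1) = M (n + 2) := rfl
        omega
      rw [h4, h1, h2]
      by_cases hn0 : n = 0
      · subst hn0; simp; ring
      · simp only [hn0, if_false]; push_cast; ring
  intro n hn
  have h1 := hlin (r - 1) (by omega)
  have h2 := h (r - 1) (by omega)
  have hr : r - 1 + 1 = r := by omega
  have hr' : r - 1 + 2 = r + 1 := by omega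
  rw [hr', hr1, h1.1, h1.2, if_pos hr] at h2
  have h3 : ((r - 1 : ℕ) : ℤ) = r - 1 := by omega
  -- The equation at the last node; for `r = 1` it is also the one at the first node.
  have h4 : (M 1 - 1) * (r + 1) = 0 := by
    rw [h3] at h2
    split_ifs at h2 with h5
    · have h6 : (r : ℤ) = 1 := by omega
      rw [h6] at h2 ⊢
      linarith
    · linarith
  have h5 : M 1 - 1 = 0 := by
    rcases mul_eq_zero.1 h4 with h5 | h5
    · exact h5
    · omega
  rw [(hlin n hn).1, h5]
  ring

theorem sum_mul_cartan (x : Fin i.length → ℤ) (a : Fin r) :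
    ∑ p, x p * CartanMatrix.A r a (i.get p) =
      2 * (∑ p, if (i.get p : ℕ) + 1 = a + 1 then x p else 0) -
        (∑ p, if (i.get p : ℕ) + 1 = a then x p else 0) -
        ∑ p, if (i.get p : ℕ) + 1 = a + 2 then x p else 0 := by
  rw [Finset.mul_sum, ← Finset.sum_sub_distrib, ← Finset.sum_sub_distrib]
  refine Finset.sum_congr rfl fun p _ => ?_
  rw [cartan_apply]
  by_cases hn : Neighbor a (i.get p)
  · rw [if_pos hn]
    unfold Neighbor at hn
    simp only [Fin.ext_iff]
    split_ifs <;> omega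
  · rw [if_neg hn]
    unfold Neighbor at hn
    simp only [Fin.ext_iff]
    split_ifs <;> omega

theorem sum_eq_one_of_weight_eq_zero {x : Fin i.length → ℤ}
    (h : weight i (theta r) x = 0) (a : Fin r) :
    (∑ p, if i.get p = a then x p else 0) = 1 := by
  have h1 := eq_one_of_cartan (r := r)
    (M := fun n => ∑ p, if (i.get p : ℕ) + 1 = n then x p else 0) (by simp)
    (Finset.sum_eq_zero fun p _ => if_neg (by have := (i.get p).2; omega))
    (fun n hn => by
      have h2 := congrFun h ⟨n, hn⟩
      rw [weight, sum_mul_cartan, Pi.zero_apply, sub_eq_zero] at h2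
      refine h2.symm.trans ?_
      simp only [theta]
      push_cast
      rfl) a a.2
  rw [← h1]
  simp only [Fin.ext_iff, Nat.add_right_cancel_iff]

/-- In a nonnegative integral point of weight zero each letter is taken at one position. -/
theorem exists_positions {x : Fin i.length → ℤ} (h0 : ∀ p, 0 ≤ x p)
    (h : weight i (theta r) x = 0) :
    ∃ P : Fin r → Fin i.length, (∀ a, i.get (P a) = a) ∧
      ∀ p, x p = if P (i.get p) = p then 1 else 0 := by
  have key : ∀ a, ∃ p, i.get p = a ∧ ∀ q, i.get q = a → x q = if p = q then 1 else 0 := by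
    intro a
    have hsum := sum_eq_one_of_weight_eq_zero h a
    have hnn : ∀ q ∈ Finset.univ, 0 ≤ if i.get q = a then x q else 0 := by
      intro q _
      split_ifs
      · exact h0 q
      · exact le_rfl
    obtain ⟨p, -, hp⟩ := Finset.exists_ne_zero_of_sum_ne_zero (hsum.trans_ne one_ne_zero)
    have hpa : i.get p = a := by
      by_contra hpa
      exact hp (if_neg hpa)
    rw [if_pos hpa] at hp
    have hp1 : 1 ≤ x p := lt_of_le_of_ne (h0 p) (Ne.symm hp)
    rw [← Finset.add_sum_erase _ _ (Finset.mem_univ p), if_pos hpa] at hsum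
    have hrest : ∀ q ∈ Finset.univ.erase p, 0 ≤ if i.get q = a then x q else 0 :=
      fun q _ => hnn q (Finset.mem_univ q)
    have hz := Finset.sum_nonneg hrest
    have hz' : ∑ q ∈ Finset.univ.erase p, (if i.get q = a then x q else 0) = 0 := by omega
    refine ⟨p, hpa, fun q hq => ?_⟩
    split_ifs with hpq
    · subst hpq
      omega
    · have := (Finset.sum_eq_zero_iff_of_nonneg hrest).1 hz' q
        (Finset.mem_erase.2 ⟨Ne.symm hpq, Finset.mem_univ q⟩)
      rwa [if_pos hq] at this
  choose P hP hP' using key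
  exact ⟨P, hP, fun p => hP' _ p rfl⟩

section Positions

variable {P : Fin r → Fin i.length} {x : Fin i.length → ℤ}

/-- For an interior letter `θ` pairs to zero, so the polytope inequality at `P c` reads `1 ≤ -∑`.
Only a neighbour taken later contributes a negative term to the sum. -/
theorem exists_neighbor_of_mem_latticePoints (hP : ∀ a, i.get (P a) = a)
    (hx : ∀ p, x p = if P (i.get p) = p then 1 else 0)
    (h : x ∈ latticePoints i (theta r)) (c : Fin r) (h0 : (c : ℕ) ≠ 0)
    (h1 : (c : ℕ) + 1 ≠ r) : ∃ d, Neighbor c d ∧ P c < P d := by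
  by_contra hcon
  push Not at hcon
  have h2 := h.2 (P c)
  have h3 : x (P c) ≤ (theta r c : ℤ) -
      ∑ q ∈ Finset.Ioi (P c), x q * CartanMatrix.A r c (i.get q) := by
    rw [hP] at h2
    beta_reduce at h2
    exact_mod_cast h2
  have h4 : 0 ≤ ∑ q ∈ Finset.Ioi (P c), x q * CartanMatrix.A r c (i.get q) := by
    refine Finset.sum_nonneg fun q hq => ?_
    rw [Finset.mem_Ioi] at hq
    rw [hx, cartan_apply]
    by_cases hn : Neighbor c (i.get q)
    · have h5 := hcon _ hn
      have h6 : P (i.get q) ≠ q := fun h6 => absurd hq (not_lt.2 (h6 ▸ h5))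
      rw [if_neg h6, zero_mul]
    · rw [if_neg hn]
      split_ifs <;> norm_num
  rw [hx, hP, if_pos rfl, theta, if_neg h0, if_neg h1] at h3
  push_cast at h3
  omega

/-- Between two occurrences of `c`, of which the first is not taken, a neighbour is taken. -/
theorem exists_neighbor_of_mem_stringCone (hP : ∀ a, i.get (P a) = a)
    (hx : ∀ p, x p = if P (i.get p) = p then 1 else 0)
    (h : (fun p => (x p : ℝ)) ∈ stringCone i) {p : Fin i.length} (hp : p < P (i.get p)) :
    ∃ d, Neighbor (i.get p) d ∧ p < P d ∧ P d < P (i.get p) := by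
  by_contra hcon
  push Not at hcon
  set c := i.get p with hc
  have hne : (Finset.univ.filter fun q => q < P c ∧ i.get q = c).Nonempty :=
    ⟨p, by simp only [Finset.mem_filter, Finset.mem_univ, true_and]; exact ⟨hp, hc.symm⟩⟩
  -- The last occurrence of `c` before `P c` makes the two occurrences consecutive, as the cone
  -- inequality requires.
  obtain ⟨q, hq, hmax⟩ := Finset.exists_max_image _ id hne
  simp only [Finset.mem_filter, Finset.mem_univ, true_and, id] at hq hmax
  have hpq := hmax p ⟨hp, hc.symm⟩
  have h1 := le_sum_of_mem_stringCone h hq.1 (by rw [hq.2, hP]) (fun s hs hs' h2 => by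
    rw [hP] at h2
    exact absurd hs (not_lt.2 (hmax s ⟨hs', h2⟩)))
  rw [Finset.sum_eq_zero] at h1
  · rw [hx, hP, if_pos rfl] at h1
    norm_num at h1
  · intro s hs
    simp only [Finset.mem_filter, Finset.mem_univ, true_and, hP] at hs
    rw [hx, if_neg, Int.cast_zero]
    intro h2
    have h3 := hcon _ hs.2.2 (by rw [h2]; exact hpq.trans_lt hs.1)
    rw [h2] at h3
    exact absurd hs.2.1 (not_lt.2 h3)

/-- If no interior letter comes after both its neighbours, then the positions of the letters
increase to both sides of the letter with the first position. -/
theorem positions_unimodal (hinj : Function.Injective P)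
    (h : ∀ c : Fin r, (c : ℕ) ≠ 0 → (c : ℕ) + 1 ≠ r → ∃ d, Neighbor c d ∧ P c < P d)
    {k : Fin r} (hk : ∀ c, P k ≤ P c) :
    (∀ c d : Fin r, k ≤ c → c < d → P c < P d) ∧ ∀ c d : Fin r, c ≤ k → d < c → P c < P d := by
  have hk' : ∀ c, c ≠ k → P k < P c :=
    fun c hc => lt_of_le_of_ne (hk c) fun h => hc (hinj h).symm
  -- Going outwards from `k`, the inner neighbour is already known to come earlier, so the later
  -- neighbour given by `h` must be the outer one.
  have hup : ∀ n : ℕ, k ≤ n → ∀ hn : n + 1 < r, P ⟨n, by omega⟩ < P ⟨n + 1, hn⟩ := by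
    intro n hkn
    induction n, hkn using Nat.le_induction with
    | base => exact fun hn => hk' _ fun h => by simp [Fin.ext_iff] at h
    | succ n hkn ih =>
      intro hn
      obtain ⟨d, hd | hd, hd'⟩ := h ⟨n + 1, by omega⟩ (by simp) (by simp; omega)
      · have : d = ⟨n + 1 + 1, hn⟩ := Fin.ext hd.symm
        rwa [this] at hd'
      · have : d = ⟨n, by omega⟩ := Fin.ext (by simpa using hd)
        rw [this] at hd'
        exact absurd (ih (by omega)) (lt_asymm hd')
  have hdown : ∀ j n : ℕ, ∀ hn : n + 1 + j = k, P ⟨n + 1, by omega⟩ < P ⟨n, by omega⟩ := by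
    intro j
    induction j with
    | zero =>
      intro n hn
      have : (⟨n + 1, by omega⟩ : Fin r) = k := Fin.ext hn
      rw [this]
      exact hk' _ fun h => by rw [← h] at hn; simp at hn
    | succ j ih =>
      intro n hn
      obtain ⟨d, hd | hd, hd'⟩ := h ⟨n + 1, by omega⟩ (by simp) (by simp; omega)
      · have : d = ⟨n + 1 + 1, by omega⟩ := Fin.ext hd.symm
        rw [this] at hd'
        exact absurd (ih (n + 1) (by omega)) (lt_asymm hd')
      · have : d = ⟨n, by omega⟩ := Fin.ext (by simpa using hd)
        rwa [this] at hd'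
  constructor
  · rintro c ⟨d, hd⟩ hc hcd
    have hcd' : (c : ℕ) + 1 ≤ d := hcd
    induction d, hcd' using Nat.le_induction with
    | base => exact hup c hc hd
    | succ d hcd' ih => exact (ih (by omega) hcd').trans (hup d (le_trans hc (by omega)) hd)
  · rintro ⟨c, hc'⟩ d hc hcd
    have hcd' : (d : ℕ) + 1 ≤ c := hcd
    induction c, hcd' using Nat.le_induction with
    | base =>
      obtain ⟨j, hj⟩ := Nat.exists_eq_add_of_le hc
      exact hdown j d hj.symm
    | succ c hcd' ih =>
      have hck : c + 1 ≤ (k : ℕ) := hc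
      obtain ⟨j, hj⟩ := Nat.exists_eq_add_of_le hck
      exact (hdown j c hj.symm).trans
        (ih (by omega) (Fin.le_def.2 (by simp only; omega)) (Fin.lt_def.2 hcd'))

theorem stepState_isSome_iff {c : Fin r} {s : Fin (r + 1) × Fin (r + 1)} :
    (stepState c s).isSome ↔
      (s.2 : ℕ) = c ∨ ((s.1 : ℕ) = c + 1 ∧ (s.1 : ℕ) ≠ s.2) := by
  unfold stepState
  simp only [ne_eq, Fin.ext_iff, Fin.val_castSucc, Fin.val_succ]
  split_ifs with h1 h2
  · simp [h1]
  · simp only [Option.isSome_some, true_iff]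
    exact Or.inr h2
  · simp only [Option.isSome_none, Bool.false_eq_true, false_iff]
    exact not_or.2 ⟨h1, h2⟩

/-- The positions of the letters are those of the raising path that starts at `z_k`. -/
theorem eq_digitFun (hP : ∀ a, i.get (P a) = a)
    (hx : ∀ p, x p = if P (i.get p) = p then 1 else 0)
    (h : (fun p => (x p : ℝ)) ∈ stringCone i) {k : Fin r}
    (hup : ∀ c d : Fin r, k ≤ c → c < d → P c < P d)
    (hdown : ∀ c d : Fin r, c ≤ k → d < c → P c < P d) (p : Fin i.length) :
    x p = digitFun i (k.castSucc, k.castSucc) p := by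
  let st : ℕ → Fin (r + 1) × Fin (r + 1) := fun m => finalState (i.take m) (k.castSucc, k.castSucc)
  -- The letters taken before position `m` form the half-open interval between the two components of
  -- the state, which starts empty at `k` and grows by one letter per move.
  let Inv : ℕ → Prop := fun m => ((st m).1 : ℕ) ≤ k ∧ (k : ℕ) ≤ (st m).2 ∧
    (((st m).1 : ℕ) < (st m).2 ∨ ((st m).1 : ℕ) = (st m).2) ∧
    ∀ c : Fin r, (P c : ℕ) < m ↔ ((st m).1 : ℕ) ≤ c ∧ (c : ℕ) < (st m).2
  have hstep : ∀ p : Fin i.length, Inv p →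
      ((stepState (i.get p) (st p)).isSome ↔ P (i.get p) = p) := by
    rintro p ⟨h1, h2, h3, h4⟩
    rw [stepState_isSome_iff]
    constructor
    · intro h5
      by_contra h6
      have h7 := h4 (i.get p)
      have h8 : p < P (i.get p) := by
        refine lt_of_le_of_ne (not_lt.1 fun h8 => ?_) (Ne.symm h6)
        have := h7.1 h8
        omega
      -- Skipping a letter that can move the state forces a neighbour to be taken strictly in
      -- between. But each neighbour is either in the interval already or farther from `k`, hence
      -- taken later.
      obtain ⟨d, hd, hd1, hd2⟩ := exists_neighbor_of_mem_stringCone hP hx h h8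
      have h9 := h4 d
      have h10 : ¬ (P d : ℕ) < p := not_lt.2 hd1.le
      rw [h9] at h10
      have h11 : ¬ (k ≤ i.get p ∧ i.get p < d) := fun h => lt_asymm hd2 (hup _ _ h.1 h.2)
      have h12 : ¬ (i.get p ≤ k ∧ d < i.get p) := fun h => lt_asymm hd2 (hdown _ _ h.1 h.2)
      rw [Fin.le_def, Fin.lt_def] at h11 h12
      unfold Neighbor at hd
      omega
    · intro h5
      by_contra h6
      have h7 := h4 (i.get p)
      rw [h5] at h7
      have h8 := (i.get p).2
      -- A taken letter that does not move the state would lie beyond the letter adjoining the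
      -- interval on its side. That letter is closer to `k`, so it was taken before and belongs to
      -- the interval, a contradiction.
      by_cases h9 : ((st p).2 : ℕ) < i.get p
      · have h10 := hup ⟨(st p).2, by omega⟩ (i.get p) h2 h9
        rw [h5] at h10
        have := (h4 _).1 h10
        simp only at this
        omega
      · by_cases h11 : ((st p).1 : ℕ) = (st p).2
        · have h10 := hdown k (i.get p) le_rfl (Fin.lt_def.2 (by omega))
          rw [h5] at h10
          have := (h4 _).1 h10
          omega
        · have h10 := hdown ⟨(st p).1 - 1, by omega⟩ (i.get p) (Fin.le_def.2 (by simp only; omega))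
            (Fin.lt_def.2 (by simp only; omega))
          rw [h5] at h10
          have := (h4 _).1 h10
          simp only at this
          omega
  have hinv : ∀ m ≤ i.length, Inv m := by
    intro m
    induction m with
    | zero =>
      intro _
      refine ⟨le_rfl, le_rfl, Or.inr rfl, fun c => ?_⟩
      simp [st, finalState]
    | succ m ih =>
      intro hm
      have h1 := ih (by omega)
      have h2 := hstep ⟨m, hm⟩ h1
      have h3 : st (m + 1) = (stepState (i.get ⟨m, hm⟩) (st m)).getD (st m) :=
        finalState_take_succ i _ ⟨m, hm⟩
      obtain ⟨h4, h5, h6, h7⟩ := h1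
      have h8 : ∀ c, (P c : ℕ) < m + 1 ↔
          (P c : ℕ) < m ∨ (c = i.get ⟨m, hm⟩ ∧ P (i.get ⟨m, hm⟩) = ⟨m, hm⟩) := by
        intro c
        rw [Nat.lt_succ_iff_lt_or_eq]
        refine or_congr Iff.rfl ⟨fun h9 => ?_, fun h9 => ?_⟩
        · have h10 : P c = ⟨m, hm⟩ := Fin.ext h9
          have h11 : c = i.get ⟨m, hm⟩ := by rw [← h10, hP]
          exact ⟨h11, h11 ▸ h10⟩
        · rw [h9.1, h9.2]
      simp only [Inv]
      simp only [h8, ← h2, h7, h3]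
      simp only at h2
      generalize st m = s at *
      generalize i.get ⟨m, hm⟩ = c at *
      cases hs : stepState c s with
      | none =>
        simp only [Option.getD_none, Option.isSome_none, Bool.false_eq_true, and_false, or_false]
        exact ⟨h4, h5, h6, fun _ => trivial⟩
      | some s' =>
        simp only [Option.getD_some, Option.isSome_some, and_true, Fin.ext_iff]
        rcases stepState_eq_some hs with ⟨h9, rfl⟩ | ⟨h9, h10, h11, rfl⟩
        · simp only [Fin.ext_iff, Fin.val_castSucc, Fin.val_succ] at h9 ⊢
          refine ⟨h4, by omega, by omega, fun d => by omega⟩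
        · simp only [Fin.ext_iff, Fin.val_castSucc, Fin.val_succ, ne_eq] at h10 h11 ⊢
          refine ⟨by omega, h5, by omega, fun d => by omega⟩
  rw [hx, digitFun_eq]
  have := hstep p (hinv p p.2.le)
  simp only [st] at this
  simp only [this]
  split_ifs <;> rfl

end Positions

theorem exists_eq_digitFun (hr : 0 < r) {x : Fin i.length → ℤ}
    (h : x ∈ latticePoints i (theta r)) (hw : weight i (theta r) x = 0) :
    ∃ k : Fin r, x = fun p => (digitFun i (k.castSucc, k.castSucc) p : ℤ) := by
  have h0 : ∀ p, 0 ≤ x p := fun p => by exact_mod_cast nonneg_of_mem_stringCone h.1 p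
  obtain ⟨P, hP, hx⟩ := exists_positions h0 hw
  have hinj : Function.Injective P := fun a b hab => by rw [← hP a, ← hP b, hab]
  have : Nonempty (Fin r) := ⟨⟨0, hr⟩⟩
  obtain ⟨k, hk⟩ := Finite.exists_min P
  obtain ⟨hup, hdown⟩ :=
    positions_unimodal hinj (exists_neighbor_of_mem_latticePoints hP hx h) hk
  exact ⟨k, funext (eq_digitFun hP hx h.1 hup hdown)⟩

end StringCrystal

open StringCrystal in
theorem mainTheorem4 (r : ℕ) (hr : 0 < r) (i : List (Fin r))
    (hi : StringCrystal.IsReducedLongest i) :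
    ∃ z : Fin r → Fin i.length → ℕ,
      -- `z k` is the vector of string coordinates of the element `z_k` of `B(θ)`
      (∀ (k : Fin r) (x : Fin i.length → ℕ),
        StringCrystal.IsStringOf i (StringCrystal.theta r) (StringCrystal.zElt k) x ↔ x = z k) ∧
      -- (i)
      {x | x ∈ StringCrystal.latticePoints i (StringCrystal.theta r) ∧
          StringCrystal.weight i (StringCrystal.theta r) x = 0} =
        Set.range (fun (k : Fin r) (p : Fin i.length) => (z k p : ℤ)) ∧
      -- (ii)
      (∀ k : Fin r,
        StringCrystal.greedy i (StringCrystal.zWord k) = some (List.ofFn (z k))) ∧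
      -- (iii)
      (∀ u v : Fin (r + 1), u < v →
        ∃ p : Fin i.length,
          (∀ q : Fin i.length, StringCrystal.IsCrossing i q u v ↔ q = p) ∧
          z ⟨0, hr⟩ p = (if u = 0 then 1 else 0) ∧
          z ⟨r - 1, Nat.sub_lt hr Nat.one_pos⟩ p = (if v = Fin.last r then 1 else 0)) := by
  refine ⟨fun k => digitFun i (k.castSucc, k.castSucc), fun k x => ?_, ?_, fun k => ?_,
    fun u v huv => ?_⟩
  · rw [zElt_eq hr]
    exact isStringOf_iff_eq_digitFun hr (validState_self k) (finalState_eq hi.1 k) x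
  · ext x
    constructor
    · rintro ⟨h, hw⟩
      obtain ⟨k, rfl⟩ := exists_eq_digitFun hr h hw
      exact ⟨k, rfl⟩
    · rintro ⟨k, rfl⟩
      obtain ⟨h1, h2⟩ := isStringOf_digitFun hr (validState_self k) (finalState_eq hi.1 k)
      refine ⟨h1.mem_latticePoints (wordWeight_highest_theta hr), ?_⟩
      obtain ⟨B, hB⟩ := h1.exists_isPath
      have h3 := hB.zero
      rw [h2, Option.some.injEq] at h3
      rw [hB.weight_eq (wordWeight_highest_theta hr), ← h3]
      funext a
      exact wordWeight_adjointWord_self a _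
  · rw [← remaining_self, ofFn_digitFun]
    exact greedy_remaining (validState_self k) (finalState_eq hi.1 k)
  · obtain ⟨p, hp, hu, hv⟩ := hi.existsUnique_crossing huv
    refine ⟨p, hp, ?_, ?_⟩
    · rw [← hu]
      exact digitFun_bottom hi p
    · rw [← hv]
      exact digitFun_top hi (Fin.ext (by simp; omega)) p
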